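/- **Model.** Let $\lambda,\beta,\rho>0$ and $c=\pi/\sqrt2$. For $L>0$ and a finite set of impurities in $(-L/2,L/2)$, let $L_1,\dots,L_n$ be the lengths of the $n$ intervals into which the impurities divide $[-L/2,L/2]$ (there are $n-1$ impurities), and let $E_s(\ell)=\pi^2s^2/(2\ell^2)$, $s\ge1$, be the eigenvalues of $-\tfrac12\Delta$ with Dirichlet conditions on an interval of length $\ell$. Let $\mathcal N_L$ be the measure that puts mass $1/L$ at each eigenvalue $E_s(L_j)$ (with multiplicity), and, for $\mu<\min_jE_1(L_j)$, put $$\rho_L(\beta,\mu)=\frac1L\sum_{j=1}^n\sum_{s=1}^\infty\frac1{e^{\beta(E_s(L_j)-\mu)}-1}.$$ The impurities are random, on a probability space $(\Omega,\mathcal F,\mathbb P)$ (a superscript $\omega$ marks the dependence on $\omega\in\Omega$), in one of the following two ways: 1. they are the points in $(-L/2,L/2)$ of a Poisson point process on $\mathbb R$ of intensity $\lambda$, and the limit is $L\to\infty$ over the reals; 2. for each $n\ge1$ they are $n-1$ independent points, uniformly distributed over $[-L_{(n)}/2,L_{(n)}/2]$, where $L_{(n)}>0$ and $n/L_{(n)}\to\lambda$;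 the joint law for different $n$ is arbitrary, and the limit $L\to\infty$ is the limit of $L=L_{(n)}$ as $n\to\infty$. Define $$n_\lambda(E)=\frac{\lambda^2c}{2}\,\frac{e^{c\lambda/\sqrt E}}{E^{3/2}\,(e^{c\lambda/\sqrt E}-1)^2},\qquad \rho(\beta,\mu)=\int_0^\infty\frac{n_\lambda(E)}{e^{\beta(E-\mu)}-1}\,dE\quad(\mu<0),\qquad \rho_c(\beta)=\lim_{\mu\uparrow0}\rho(\beta,\mu).$$ **Proposition.** The limit $\rho_c(\beta)$ exists and is finite, and in both models the following holds. Almost surely, in each volume the equation $\rho=\rho_L^\omega(\beta,\mu)$ has exactly one solution $\mu=\mu_L^\omega(\beta,\rho)$ below the spectrum, i.e. with $\mu<\min_jE_1(L_j^\omega)$. (a) If $\rho<\rho_c(\beta)$, the equation $\rho=\rho(\beta,\mu)$ has exactly one root $\mu(\beta,\rho)<0$, and almost surely $\lim_{L\to\infty}\mu_L^\omega(\beta,\rho)=\mu(\beta,\rho)$. (b) If $\rho\ge\rho_c(\beta)$, then almost surely $\lim_{L\to\infty}\mu_L^\omega(\beta,\rho)=0$. Moreover, for every $\varepsilon>0$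 the almost sure limit in $$\rho_0(\beta,\rho):=\lim_{\varepsilon\downarrow0}\Big\{\text{a.s.-}\lim_{L\to\infty}\int_{(0,\varepsilon]}\frac{\mathcal N_L^\omega(dE)}{e^{\beta(E-\mu_L^\omega(\beta,\rho))}-1}\Big\}$$ exists and is nonrandom, the limit $\varepsilon\downarrow0$ exists, and the generalized condensate density is $\rho_0(\beta,\rho)=\rho-\rho_c(\beta)$ if $\rho\ge\rho_c(\beta)$ and $\rho_0(\beta,\rho)=0$ if $\rho<\rho_c(\beta)$. -/

import Mathlib

open MeasureTheory ProbabilityTheory Filter Topology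

noncomputable section

namespace LuttingerSy

/-- The nodes in the volume `[-L/2, L/2]`: the impurities inside it and the two walls. -/
def nodes (L : ℝ) (X : Set ℝ) : Set ℝ :=
  (X ∩ Set.Ioo (-(L / 2)) (L / 2)) ∪ {-(L / 2), L / 2}

/-- The intervals between consecutive nodes, each given by its pair of end points. -/
def boxes (L : ℝ) (X : Set ℝ) : Set (ℝ × ℝ) :=
  {p | p.1 ∈ nodes L X ∧ p.2 ∈ nodes L X ∧ p.1 < p.2 ∧
    Disjoint (Set.Ioo p.1 p.2) (nodes L X)}

/-- The `s`-th eigenvalue (`s = 1, 2, …`) of `-Δ/2` with Dirichlet conditions on an interval of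
length `ℓ`. -/
def energy (s : ℕ) (ℓ : ℝ) : ℝ := Real.pi ^ 2 * (s : ℝ) ^ 2 / (2 * ℓ ^ 2)

/-- The eigenvalues (with multiplicity) of the one-particle Hamiltonian in `[-L/2, L/2]`,
the direct sum of the Dirichlet operators of the boxes; the label `(p, k)` stands for the level
`s = k + 1` of the box `p`. -/
def level (L : ℝ) (X : Set ℝ) (q : boxes L X × ℕ) : ℝ :=
  energy (q.2 + 1) (q.1.1.2 - q.1.1.1)

/-- Bose occupation number. -/
def bose (β μ E : ℝ) : ℝ := 1 / (Real.exp (β * (E - μ)) - 1)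

/-- `μ` is an admissible chemical potential (below the whole one-particle spectrum), and the
grand-canonical density in `[-L/2, L/2]` converges and equals `ρ`. -/
def SolvesDensityEq (L : ℝ) (X : Set ℝ) (β ρ μ : ℝ) : Prop :=
  (∀ q, μ < level L X q) ∧ HasSum (fun q => 1 / L * bose β μ (level L X q)) ρ

/-- The finite-volume density-of-states measure: mass `1 / L` at every eigenvalue. -/
def idsMeasure (L : ℝ) (X : Set ℝ) : Measure ℝ :=
  ENNReal.ofReal (1 / L) • Measure.sum (fun q => Measure.dirac (level L X q))

/-- Density of the particles with energy at most `ε`. -/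
def lowEnergyDensity (L : ℝ) (X : Set ℝ) (β μ ε : ℝ) : ℝ :=
  ∫ E in Set.Ioc 0 ε, bose β μ E ∂(idsMeasure L X)

/-- The constant `π / √2`. -/
def cc : ℝ := Real.pi / √2

/-- The limiting density of states, for impurity concentration `lam`. -/
def dos (lam E : ℝ) : ℝ :=
  lam ^ 2 * cc / 2 * Real.exp (cc * lam / √E) /
    (E ^ (3 / 2 : ℝ) * (Real.exp (cc * lam / √E) - 1) ^ 2)

/-- The limiting particle density `ρ(β, μ)`. -/
def rho (lam β μ : ℝ) : ℝ := ∫ E in Set.Ioi 0, dos lam E * bose β μ E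

/-- The critical density. -/
def rhoCrit (lam β : ℝ) : ℝ := limUnder (𝓝[<] (0 : ℝ)) (fun μ => rho lam β μ)

/-- `X` is (the random set of atoms of) a homogeneous Poisson point process on `ℝ` with
intensity `lam`. -/
structure IsPoissonProcess {Ω : Type*} [MeasurableSpace Ω] (P : Measure Ω) (lam : ℝ)
    (X : Ω → Set ℝ) : Prop where
  measurable_count : ∀ B : Set ℝ, MeasurableSet B → Bornology.IsBounded B →
    Measurable (fun ω => (X ω ∩ B).encard)
  law_count : ∀ B : Set ℝ, MeasurableSet B → Bornology.IsBounded B → ∀ m : ℕ,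
    P {ω | (X ω ∩ B).encard = m} =
      ENNReal.ofReal ((lam * volume.real B) ^ m / (m.factorial : ℝ) *
        Real.exp (-(lam * volume.real B)))
  indep_count : ∀ (m : ℕ) (B : Fin m → Set ℝ), (∀ i, MeasurableSet (B i)) →
    (∀ i, Bornology.IsBounded (B i)) → Pairwise (fun i j => Disjoint (B i) (B j)) →
    iIndepFun (fun i ω => (X ω ∩ B i).encard) P

/-- For every `n ≥ 1`, the points `ξ n i` are `n - 1` independent impurities, uniformly
distributed over `[-L n / 2, L n / 2]`, and the concentration `n / L n` tends to `lam`. Nothing is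
assumed on the joint law of the configurations for different `n`. -/
structure IsUniformModel {Ω : Type*} [MeasurableSpace Ω] (P : Measure Ω) (lam : ℝ)
    (L : ℕ → ℝ) (ξ : (n : ℕ) → Fin (n - 1) → Ω → ℝ) : Prop where
  length_pos : ∀ n, 0 < L n
  concentration : Tendsto (fun n : ℕ => (n : ℝ) / L n) atTop (𝓝 lam)
  measurable_point : ∀ n i, Measurable (ξ n i)
  indep_points : ∀ n, iIndepFun (ξ n) P
  uniform_point : ∀ n i, pdf.IsUniform (ξ n i) (Set.Icc (-(L n / 2)) (L n / 2)) P volume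

/-- The asymptotics of the chemical potential and of the condensate at density `ρ`, for a family
of random impurity configurations `X i` in the volumes `[-L i / 2, L i / 2]`, along the filter `l`:
* almost surely the density equation has exactly one solution in each volume;
* if `ρ < ρ_c`, the equation `ρ = ρ(β, μ)` has exactly one negative root, the finite-volume
  solutions converge to it almost surely, and the generalized condensate density is `0`;
* if `ρ ≥ ρ_c`, the finite-volume solutions converge to `0` almost surely, and the generalized
  condensate density is `ρ - ρ_c`.
The function `g` is the (nonrandom) almost sure limit of the density of particles with energy at
most `ε`, in the definition of the generalized condensate density. -/
def CondensationAsymptotics {Ω ι : Type*} [MeasurableSpace Ω] (P : Measure Ω) (l : Filter ι)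
    (L : ι → ℝ) (X : ι → Ω → Set ℝ) (lam β ρ : ℝ) : Prop :=
  (∀ᵐ ω ∂P, ∀ i, 0 < L i → ∃! m : ℝ, SolvesDensityEq (L i) (X i ω) β ρ m) ∧
  ∀ μ : ι → Ω → ℝ,
    (∀ᵐ ω ∂P, ∀ᶠ i in l, SolvesDensityEq (L i) (X i ω) β ρ (μ i ω)) →
    (ρ < rhoCrit lam β →
      (∃ μ₀ : ℝ, μ₀ < 0 ∧ rho lam β μ₀ = ρ ∧ (∀ m < 0, rho lam β m = ρ → m = μ₀) ∧
        ∀ᵐ ω ∂P, Tendsto (fun i => μ i ω) l (𝓝 μ₀)) ∧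
      ∃ g : ℝ → ℝ,
        (∀ ε > 0, ∀ᵐ ω ∂P,
          Tendsto (fun i => lowEnergyDensity (L i) (X i ω) β (μ i ω) ε) l (𝓝 (g ε))) ∧
        Tendsto g (𝓝[>] 0) (𝓝 0)) ∧
    (rhoCrit lam β ≤ ρ →
      (∀ᵐ ω ∂P, Tendsto (fun i => μ i ω) l (𝓝 0)) ∧
      ∃ g : ℝ → ℝ,
        (∀ ε > 0, ∀ᵐ ω ∂P,
          Tendsto (fun i => lowEnergyDensity (L i) (X i ω) β (μ i ω) ε) l (𝓝 (g ε))) ∧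
        Tendsto g (𝓝[>] 0) (𝓝 (ρ - rhoCrit lam β)))

end LuttingerSy

end

/-! The only random input is the void fraction: the share of the volume covered by the left end
points `y` for which `(y, y + x)` lies in the volume and meets no impurity. A box of length `ℓ`
contributes `(ℓ - x)₊`, so the void fraction is the spatial average of `(ℓ - x)₊`
(`voidFraction_eq_boxAvg`). If it tends to `exp (-lam x)` for every `x > 0`, everything else is
deterministic. The levels up to `t` in a box number `⌊ℓ / a⌋` with `a = cc / √t`, a sum of
indicators of `ℓ ≥ a s`. Difference quotients of `x ↦ (ℓ - x)₊` sandwich these, so the eigenvalue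
count tends to `∑ lam exp (-lam a s) = ids lam t` (`tendsto_average_natFloor`). A layer-cake formula
turns this into convergence of the density above `ε`, even along moving chemical potentials whose
limit is below `ε` (`HasPoissonVoids.tendsto_lintegral_bose`); the bound `√t / cc` on the count,
valid in every volume, gives domination. The density increases with the chemical potential.
Comparison with fixed negative values locates `μ` up to `0`, and positive limit points are excluded
because the spectrum reaches down to `0` in the limit. The condensate is what remains of `ρ` after
the convergent part above `ε` is removed; `dos` vanishes so fast at `0` that the critical density is
finite. Void fractions are handled by different means in the two models. For uniform points the mean
is explicit, and bounded differences with Borel–Cantelli give almost sure convergence whatever the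
joint law of the volumes. For the Poisson process, space is cut into cells and the strong law is
applied to disjoint windows. -/

noncomputable section

namespace LuttingerSy

/-! ### Geometry of the boxes -/

/-- The left end points of the intervals of length `x` inside the volume that are free of
impurities. -/
def voidSet (L : ℝ) (X : Set ℝ) (x : ℝ) : Set ℝ :=
  {y | -(L / 2) ≤ y ∧ y + x ≤ L / 2 ∧ Disjoint (Set.Ioo y (y + x)) X}

/-- The fraction of the volume covered by `voidSet`. -/
def voidFraction (L : ℝ) (X : Set ℝ) (x : ℝ) : ℝ := 1 / L * volume.real (voidSet L X x)

lemma nodes_finite {L : ℝ} {X : Set ℝ} (h : (X ∩ Set.Ioo (-(L / 2)) (L / 2)).Finite) :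
    (nodes L X).Finite :=
  h.union (by simp)

lemma boxes_finite {L : ℝ} {X : Set ℝ} (h : (X ∩ Set.Ioo (-(L / 2)) (L / 2)).Finite) :
    (boxes L X).Finite :=
  ((nodes_finite h).prod (nodes_finite h)).subset fun _ hp => ⟨hp.1, hp.2.1⟩

lemma left_mem_nodes (L : ℝ) (X : Set ℝ) : -(L / 2) ∈ nodes L X := by simp [nodes]

lemma right_mem_nodes (L : ℝ) (X : Set ℝ) : L / 2 ∈ nodes L X := by simp [nodes]

lemma nodes_subset_Icc {L : ℝ} (hL : 0 < L) (X : Set ℝ) :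
    nodes L X ⊆ Set.Icc (-(L / 2)) (L / 2) := by
  rintro z (⟨-, h⟩ | h | h)
  · exact ⟨h.1.le, h.2.le⟩
  · rw [h]; constructor <;> linarith
  · rw [Set.mem_singleton_iff] at h; rw [h]; constructor <;> linarith

/-- The box runs from the largest node up to `u` to the smallest node from `v` on; both exist
because the walls are nodes and there are finitely many nodes. -/
lemma exists_box {L : ℝ} {X : Set ℝ} (h : (X ∩ Set.Ioo (-(L / 2)) (L / 2)).Finite) {u v : ℝ}
    (hu : -(L / 2) ≤ u) (huv : u < v) (hv : v ≤ L / 2) (hd : Disjoint (Set.Ioo u v) (nodes L X)) :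
    ∃ p ∈ boxes L X, p.1 ≤ u ∧ v ≤ p.2 := by
  obtain ⟨a, ⟨ha, hau⟩, hmax⟩ := Set.exists_max_image {z | z ∈ nodes L X ∧ z ≤ u} id
    ((nodes_finite h).subset fun _ hz => hz.1) ⟨_, left_mem_nodes L X, hu⟩
  obtain ⟨b, ⟨hb, hvb⟩, hmin⟩ := Set.exists_min_image {z | z ∈ nodes L X ∧ v ≤ z} id
    ((nodes_finite h).subset fun _ hz => hz.1) ⟨_, right_mem_nodes L X, hv⟩
  refine ⟨(a, b), ⟨ha, hb, by simp only; linarith, ?_⟩, hau, hvb⟩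
  rw [Set.disjoint_left]
  rintro z ⟨hz1, hz2⟩ hz
  simp only at hz1 hz2
  rcases le_or_gt z u with h1 | h1
  · have := hmax z ⟨hz, h1⟩
    simp only [id] at this; linarith
  rcases le_or_gt v z with h2 | h2
  · have := hmin z ⟨hz, h2⟩
    simp only [id] at this; linarith
  · exact Set.disjoint_left.1 hd ⟨h1, h2⟩ hz

lemma boxes_nonempty {L : ℝ} (hL : 0 < L) {X : Set ℝ}
    (h : (X ∩ Set.Ioo (-(L / 2)) (L / 2)).Finite) : (boxes L X).Nonempty := by
  obtain ⟨b, ⟨hb, hvb⟩, hmin⟩ := Set.exists_min_image {z | z ∈ nodes L X ∧ -(L / 2) < z} id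
    ((nodes_finite h).subset fun _ hz => hz.1) ⟨_, right_mem_nodes L X, by linarith⟩
  obtain ⟨p, hp, -⟩ := exists_box h le_rfl hvb (nodes_subset_Icc hL X hb).2 (by
    rw [Set.disjoint_left]
    rintro z ⟨hz1, hz2⟩ hz
    have := hmin z ⟨hz, hz1⟩
    simp only [id] at this; linarith)
  exact ⟨p, hp⟩

/-- If end points differed, one of them would be a node in the interior of the other box. -/
lemma box_eq_of_overlap {L : ℝ} {X : Set ℝ} {p q : ℝ × ℝ} (hp : p ∈ boxes L X)
    (hq : q ∈ boxes L X) (h1 : p.1 < q.2) (h2 : q.1 < p.2) : p = q := by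
  obtain ⟨hp1, hp2, -, hpd⟩ := hp
  obtain ⟨hq1, hq2, -, hqd⟩ := hq
  rw [Set.disjoint_left] at hpd hqd
  refine Prod.ext ?_ ?_
  · rcases lt_trichotomy p.1 q.1 with h | h | h
    · exact (hpd ⟨h, h2⟩ hq1).elim
    · exact h
    · exact (hqd ⟨h, h1⟩ hp1).elim
  · rcases lt_trichotomy p.2 q.2 with h | h | h
    · exact (hqd ⟨h2, h⟩ hp2).elim
    · exact h
    · exact (hpd ⟨h1, h⟩ hq2).elim

/-- A void interval is open and inside the volume, so it avoids the walls as well as the impurities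
and fits into a box. Boxes shorter than `x` contribute an empty `Icc`. -/
lemma voidSet_eq_iUnion {L : ℝ} (hL : 0 < L) {X : Set ℝ}
    (h : (X ∩ Set.Ioo (-(L / 2)) (L / 2)).Finite) {x : ℝ} (hx : 0 < x) :
    voidSet L X x = ⋃ p : boxes L X, Set.Icc p.1.1 (p.1.2 - x) := by
  ext y
  simp only [Set.mem_iUnion]
  constructor
  · rintro ⟨h1, h2, h3⟩
    obtain ⟨p, hp, hp1, hp2⟩ := exists_box h h1 (by linarith : y < y + x) h2 (by
      rw [Set.disjoint_left] at h3 ⊢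
      rintro z hz (hz' | hz' | hz')
      · exact h3 hz hz'.1
      · rw [hz'] at hz; linarith [hz.1]
      · rw [Set.mem_singleton_iff] at hz'
        rw [hz'] at hz; linarith [hz.2])
    exact ⟨⟨p, hp⟩, hp1, by simp only; linarith⟩
  · rintro ⟨⟨p, hp1, hp2, hp3, hp4⟩, hy1, hy2⟩
    simp only at hy1 hy2
    have b1 := nodes_subset_Icc hL X hp1
    have b2 := nodes_subset_Icc hL X hp2
    refine ⟨b1.1.trans hy1, by linarith [b2.2], ?_⟩
    rw [Set.disjoint_left] at hp4 ⊢
    rintro z hz hzX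
    have hz' : z ∈ Set.Ioo p.1 p.2 := ⟨by linarith [hz.1], by linarith [hz.2]⟩
    exact hp4 hz' (Or.inl ⟨hzX, by linarith [hz'.1, b1.1], by linarith [hz'.2, b2.2]⟩)

/-- The spatial average, over the volume, of a function of the box lengths. -/
def boxAvg (L : ℝ) (X : Set ℝ) [Finite (boxes L X)] : (ℝ → ℝ) →ₗ[ℝ] ℝ where
  toFun f := 1 / L * ∑' p : boxes L X, f (p.1.2 - p.1.1)
  map_add' f g := by
    have := Fintype.ofFinite (boxes L X)
    simp only [tsum_fintype, Pi.add_apply, Finset.sum_add_distrib, mul_add]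
  map_smul' c f := by
    have := Fintype.ofFinite (boxes L X)
    simp only [tsum_fintype, Pi.smul_apply, smul_eq_mul, ← Finset.mul_sum, RingHom.id_apply]
    ring

lemma boxAvg_le_of_pos {L : ℝ} (hL : 0 < L) (X : Set ℝ) [Finite (boxes L X)] {f g : ℝ → ℝ}
    (h : ∀ ℓ, 0 < ℓ → f ℓ ≤ g ℓ) : boxAvg L X f ≤ boxAvg L X g := by
  have := Fintype.ofFinite (boxes L X)
  simp only [boxAvg, LinearMap.coe_mk, AddHom.coe_mk, tsum_fintype]
  gcongr with p _
  exact h _ (sub_pos.2 p.2.2.2.1)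

/-- The intervals in `voidSet_eq_iUnion` are disjoint by `box_eq_of_overlap`, so their lengths add
up. -/
lemma voidFraction_eq_boxAvg {L : ℝ} (hL : 0 < L) {X : Set ℝ}
    (h : (X ∩ Set.Ioo (-(L / 2)) (L / 2)).Finite) [Finite (boxes L X)] {x : ℝ} (hx : 0 < x) :
    voidFraction L X x = boxAvg L X (fun ℓ => max (ℓ - x) 0) := by
  have := Fintype.ofFinite (boxes L X)
  simp only [boxAvg, LinearMap.coe_mk, AddHom.coe_mk, tsum_fintype, voidFraction]
  rw [voidSet_eq_iUnion hL h hx, measureReal_def, measure_iUnion, tsum_fintype,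
    ENNReal.toReal_sum (by simp)]
  · congr 1
    refine Finset.sum_congr rfl fun p _ => ?_
    rw [Real.volume_Icc, ENNReal.toReal_ofReal']
    congr 1; ring
  · intro p q hpq
    refine Set.disjoint_left.2 fun y hy hy' => hpq (Subtype.ext ?_)
    exact box_eq_of_overlap p.2 q.2 (by linarith [hy.1, hy'.2]) (by linarith [hy.2, hy'.1])
  · exact fun _ => measurableSet_Icc

lemma voidSet_anti (L : ℝ) (X : Set ℝ) {x y : ℝ} (h : x ≤ y) : voidSet L X y ⊆ voidSet L X x :=
  fun z hz => ⟨hz.1, by linarith [hz.2.1],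
    hz.2.2.mono_left (Set.Ioo_subset_Ioo_right (by linarith))⟩

lemma voidSet_subset_Icc (L : ℝ) (X : Set ℝ) (x : ℝ) :
    voidSet L X x ⊆ Set.Icc (-(L / 2)) (L / 2 - x) :=
  fun z hz => ⟨hz.1, by linarith [hz.2.1]⟩

lemma voidFraction_anti {L : ℝ} (hL : 0 < L) (X : Set ℝ) : Antitone (voidFraction L X) := by
  intro x y h
  unfold voidFraction
  refine mul_le_mul_of_nonneg_left (measureReal_mono (voidSet_anti L X h) ?_) (by positivity)
  exact measure_ne_top_of_subset (voidSet_subset_Icc L X x) (measure_Icc_lt_top (μ := volume)).ne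

/-- The box lengths add up to at most `L`. This follows from `ℓ - x ≤ (ℓ - x)₊` and the trivial
bound on the void fraction, as `x` decreases to `0`. -/
lemma boxAvg_id_le_one {L : ℝ} (hL : 0 < L) {X : Set ℝ}
    (h : (X ∩ Set.Ioo (-(L / 2)) (L / 2)).Finite) [Finite (boxes L X)] :
    boxAvg L X (fun ℓ => ℓ) ≤ 1 := by
  have key : ∀ x : ℝ, 0 < x →
      boxAvg L X (fun ℓ => ℓ) - x * boxAvg L X (fun _ => 1) ≤ 1 := by
    intro x hx
    have e : boxAvg L X (fun ℓ => ℓ) - x * boxAvg L X (fun _ => 1)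
        = boxAvg L X ((fun ℓ => ℓ) - x • (fun _ => 1)) := by simp
    rw [e]
    calc _ ≤ boxAvg L X (fun ℓ => max (ℓ - x) 0) := by
          refine boxAvg_le_of_pos hL X fun ℓ _ => ?_
          simp
      _ = voidFraction L X x := (voidFraction_eq_boxAvg hL h hx).symm
      _ ≤ 1 / L * L := by
          unfold voidFraction
          gcongr
          refine (measureReal_mono (voidSet_subset_Icc L X x)
            measure_Icc_lt_top.ne).trans ?_
          rw [measureReal_def, Real.volume_Icc, ENNReal.toReal_ofReal']
          exact max_le (by linarith) hL.le
      _ = 1 := by field_simp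
  have lim : Tendsto (fun x : ℝ => boxAvg L X (fun ℓ => ℓ) - x * boxAvg L X (fun _ => 1))
      (𝓝[>] 0) (𝓝 (boxAvg L X (fun ℓ => ℓ) - 0 * boxAvg L X (fun _ => 1))) :=
    ((Continuous.tendsto (by fun_prop) 0)).mono_left nhdsWithin_le_nhds
  rw [zero_mul, sub_zero] at lim
  exact le_of_tendsto lim (eventually_nhdsWithin_of_forall fun x hx => key x hx)

/-! ### The counting function -/

lemma cc_pos : 0 < cc := by unfold cc; positivity

lemma energy_le_iff {s : ℕ} {ℓ t : ℝ} (hℓ : 0 < ℓ) (ht : 0 < t) :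
    energy s ℓ ≤ t ↔ (s : ℝ) ≤ ℓ / (cc / √t) := by
  have h1 : energy s ℓ = (cc * s / ℓ) ^ 2 := by
    unfold energy cc
    rw [div_pow, mul_pow, div_pow, Real.sq_sqrt (by norm_num)]
    field_simp
  have hc := cc_pos
  have hst : 0 < √t := Real.sqrt_pos.2 ht
  rw [h1, ← Real.le_sqrt (by positivity) ht.le, div_le_iff₀ hℓ, div_div_eq_mul_div,
    le_div_iff₀ hc, mul_comm cc, mul_comm ℓ]

lemma energy_pos {s : ℕ} (hs : 0 < s) {ℓ : ℝ} (hℓ : 0 < ℓ) : 0 < energy s ℓ := by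
  unfold energy
  have : (0 : ℝ) < s := by exact_mod_cast hs
  positivity

lemma level_pos {L : ℝ} {X : Set ℝ} (q : boxes L X × ℕ) : 0 < level L X q :=
  energy_pos (Nat.succ_pos _) (sub_pos.2 q.1.2.2.2.1)

lemma idsMeasure_apply {L : ℝ} {X : Set ℝ} {s : Set ℝ} (hs : MeasurableSet s) :
    idsMeasure L X s
      = ENNReal.ofReal (1 / L) * ∑' q : boxes L X × ℕ, s.indicator 1 (level L X q) := by
  simp [idsMeasure, Measure.sum_apply _ hs, Measure.dirac_apply' _ hs]

lemma lintegral_idsMeasure {L : ℝ} {X : Set ℝ} {f : ℝ → ENNReal} (hf : Measurable f) :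
    ∫⁻ E, f E ∂(idsMeasure L X)
      = ENNReal.ofReal (1 / L) * ∑' q : boxes L X × ℕ, f (level L X q) := by
  simp [idsMeasure, lintegral_sum_measure, lintegral_dirac' _ hf]

lemma idsMeasure_Iic_zero (L : ℝ) (X : Set ℝ) : idsMeasure L X (Set.Iic 0) = 0 := by
  rw [idsMeasure_apply measurableSet_Iic]
  simp [Set.indicator, (level_pos _).not_ge]

lemma idsMeasure_Iic {L : ℝ} (hL : 0 < L) (X : Set ℝ) [Finite (boxes L X)] {t : ℝ} (ht : 0 < t) :
    idsMeasure L X (Set.Iic t)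
      = ENNReal.ofReal (boxAvg L X (fun ℓ => (⌊ℓ / (cc / √t)⌋₊ : ℝ))) := by
  have := Fintype.ofFinite (boxes L X)
  simp only [boxAvg, LinearMap.coe_mk, AddHom.coe_mk, tsum_fintype]
  rw [idsMeasure_apply measurableSet_Iic, ENNReal.ofReal_mul (by positivity), ENNReal.tsum_prod',
    tsum_fintype, ENNReal.ofReal_sum_of_nonneg (fun _ _ => by positivity)]
  congr 1
  refine Finset.sum_congr rfl fun p _ => ?_
  have hp : 0 < p.1.2 - p.1.1 := sub_pos.2 p.2.2.2.1
  -- The label `k` stands for the level `s = k + 1`, so `k < ⌊ℓ / a⌋` says exactly that this level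
  -- is at most `t`.
  rw [tsum_eq_sum (s := Finset.range ⌊(p.1.2 - p.1.1) / (cc / √t)⌋₊)]
  · rw [Finset.sum_congr rfl (g := fun _ => 1)]
    · simp
    · intro k hk
      rw [Set.indicator_of_mem]; · rfl
      rw [Set.mem_Iic, level, energy_le_iff hp ht]
      exact (Nat.le_floor_iff' (Nat.succ_ne_zero k)).1 (Finset.mem_range.1 hk)
  · intro k hk
    rw [Set.indicator_of_notMem]
    rw [Set.mem_Iic, level, energy_le_iff hp ht]
    exact fun h => hk (Finset.mem_range.2 ((Nat.le_floor_iff' (Nat.succ_ne_zero k)).2 h))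

/-- Drop the floor and use `boxAvg_id_le_one`. The bound does not depend on the configuration, so it
can serve as a dominating function. -/
lemma idsMeasure_Iic_le {L : ℝ} (hL : 0 < L) {X : Set ℝ}
    (h : (X ∩ Set.Ioo (-(L / 2)) (L / 2)).Finite) {t : ℝ} (ht : 0 < t) :
    idsMeasure L X (Set.Iic t) ≤ ENNReal.ofReal (√t / cc) := by
  have : Finite (boxes L X) := boxes_finite h
  have hc := cc_pos
  have hst : 0 < √t := Real.sqrt_pos.2 ht
  rw [idsMeasure_Iic hL X ht]
  refine ENNReal.ofReal_le_ofReal ?_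
  calc _ ≤ boxAvg L X ((√t / cc) • (fun ℓ => ℓ)) := by
        refine boxAvg_le_of_pos hL X fun ℓ hℓ => ?_
        refine (Nat.floor_le (by positivity)).trans_eq ?_
        simp only [Pi.smul_apply, smul_eq_mul]
        field_simp
    _ ≤ √t / cc * 1 := by
        rw [map_smul, smul_eq_mul]
        exact mul_le_mul_of_nonneg_left (boxAvg_id_le_one hL h) (by positivity)
    _ = _ := mul_one _

/-! ### From void fractions to the integrated density of states -/

/-- Squeezing by a family of bounds whose limits pinch the target. -/
lemma tendsto_of_squeeze_family {ι κ : Type*} {l : Filter ι} {m : Filter κ} [NeBot m]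
    {f : ι → ℝ} {x : ℝ} {lo hi : κ → ι → ℝ} {lo' hi' : κ → ℝ}
    (hlo : ∀ᶠ k in m, Tendsto (lo k) l (𝓝 (lo' k)))
    (hhi : ∀ᶠ k in m, Tendsto (hi k) l (𝓝 (hi' k)))
    (hlf : ∀ᶠ k in m, ∀ᶠ i in l, lo k i ≤ f i) (hfh : ∀ᶠ k in m, ∀ᶠ i in l, f i ≤ hi k i)
    (hlo' : Tendsto lo' m (𝓝 x)) (hhi' : Tendsto hi' m (𝓝 x)) : Tendsto f l (𝓝 x) := by
  refine tendsto_order.2 ⟨fun a ha => ?_, fun a ha => ?_⟩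
  · obtain ⟨k, h1, h2, h3⟩ := (hlo.and (hlf.and (hlo'.eventually (lt_mem_nhds ha)))).exists
    filter_upwards [h2, h1.eventually (lt_mem_nhds h3)] with i hi1 hi2 using hi2.trans_le hi1
  · obtain ⟨k, h1, h2, h3⟩ := (hhi.and (hfh.and (hhi'.eventually (gt_mem_nhds ha)))).exists
    filter_upwards [h2, h1.eventually (gt_mem_nhds h3)] with i hi1 hi2 using hi1.trans_lt hi2

lemma natFloor_div_eq_sum {a : ℝ} (ha : 0 < a) (ℓ : ℝ) {S : ℕ} (hS : ⌊ℓ / a⌋₊ ≤ S) :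
    (⌊ℓ / a⌋₊ : ℝ) = ∑ s ∈ Finset.range S, if a * (s + 1) ≤ ℓ then (1 : ℝ) else 0 := by
  rw [Finset.sum_ite, Finset.sum_const_zero, add_zero, Finset.sum_const, nsmul_eq_mul, mul_one]
  congr 1
  rw [← Finset.card_range ⌊ℓ / a⌋₊]
  congr 1
  ext s
  have : s < ⌊ℓ / a⌋₊ ↔ a * (s + 1) ≤ ℓ := by
    rw [← Nat.succ_le_iff, Nat.le_floor_iff' (Nat.succ_ne_zero s), le_div_iff₀ ha, mul_comm]
    push_cast; rfl
  rw [Finset.mem_range, Finset.mem_filter, Finset.mem_range, ← this]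
  exact ⟨fun h => ⟨h.trans_le hS, h⟩, fun h => h.2⟩

lemma sum_ite_le_natFloor_div {a : ℝ} (ha : 0 < a) (ℓ : ℝ) (S : ℕ) :
    ∑ s ∈ Finset.range S, (if a * (s + 1) ≤ ℓ then (1 : ℝ) else 0) ≤ (⌊ℓ / a⌋₊ : ℝ) := by
  rw [natFloor_div_eq_sum ha ℓ (le_max_right S _)]
  refine Finset.sum_le_sum_of_subset_of_nonneg (Finset.range_mono (le_max_left _ _)) ?_
  intros; positivity

/-- The multiples of `a` beyond `a * S` are paid for by a term proportional to `(ℓ - a S)₊`, whose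
average is again a void fraction. -/
lemma natFloor_div_le_sum_ite {a : ℝ} (ha : 0 < a) {ℓ : ℝ} (hℓ : 0 < ℓ) (S : ℕ) :
    (⌊ℓ / a⌋₊ : ℝ) ≤ ∑ s ∈ Finset.range S, (if a * (s + 1) ≤ ℓ then (1 : ℝ) else 0)
      + 1 / a * max (ℓ - a * S) 0 := by
  have h0 : 0 ≤ 1 / a * max (ℓ - a * S) 0 := by positivity
  rcases le_total ⌊ℓ / a⌋₊ S with h | h
  · rw [← natFloor_div_eq_sum ha ℓ h]; linarith
  · have h1 : ∑ s ∈ Finset.range S, (if a * (s + 1) ≤ ℓ then (1 : ℝ) else 0) = S := by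
      rw [Finset.sum_congr rfl (g := fun _ => (1 : ℝ))]
      · simp
      · intro s hs
        rw [if_pos]
        have : s + 1 ≤ ⌊ℓ / a⌋₊ := (Finset.mem_range.1 hs).trans_le h
        rw [Nat.le_floor_iff' (Nat.succ_ne_zero s), le_div_iff₀ ha, mul_comm] at this
        exact_mod_cast this
    have h2 : (⌊ℓ / a⌋₊ : ℝ) ≤ ℓ / a := Nat.floor_le (by positivity)
    have h3 : 1 / a * (ℓ - a * S) ≤ 1 / a * max (ℓ - a * S) 0 := by gcongr; exact le_max_left _ _
    have h4 : 1 / a * (ℓ - a * S) = ℓ / a - S := by field_simp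
    rw [h1]; linarith

/-- The limiting integrated density of states. -/
def ids (lam E : ℝ) : ℝ := lam / (Real.exp (cc * lam / √E) - 1)

/-- If the averages of `ℓ ↦ (ℓ - x)₊` converge to `exp (-lam x)`, then those of `ℓ ↦ ⌊ℓ / a⌋`
converge to `lam / (exp (lam a) - 1)`. -/
lemma tendsto_average_natFloor {ι : Type*} {l : Filter ι} {A : ι → (ℝ → ℝ) →ₗ[ℝ] ℝ}
    (hmono : ∀ᶠ i in l, ∀ f g : ℝ → ℝ, (∀ ℓ, 0 < ℓ → f ℓ ≤ g ℓ) → A i f ≤ A i g) {lam : ℝ}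
    (hlam : 0 < lam)
    (hA : ∀ x > 0, Tendsto (fun i => A i (fun ℓ => max (ℓ - x) 0)) l (𝓝 (Real.exp (-(lam * x)))))
    {a : ℝ} (ha : 0 < a) :
    Tendsto (fun i => A i (fun ℓ => (⌊ℓ / a⌋₊ : ℝ))) l (𝓝 (lam / (Real.exp (lam * a) - 1))) := by
  set r : ℝ → ℝ → ℝ := fun x ℓ => max (ℓ - x) 0 with hr
  -- The `2` ensures `h k < a`, so that the arguments `a * (s + 1) - h k` below stay positive, as
  -- `hA` requires.
  set h : ℕ → ℝ := fun k => a / (k + 2) with hh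
  have hpos : ∀ k, 0 < h k := fun k => by positivity
  have hlt : ∀ k, h k < a := fun k => by
    rw [hh]; simp only; rw [div_lt_iff₀ (by positivity)]; nlinarith [(Nat.cast_nonneg k : (0:ℝ) ≤ k)]
  -- The forward difference quotient of `x ↦ (ℓ - x)₊` at `a (s + 1)` lies below the indicator of `a
  -- (s + 1) ≤ ℓ`, the backward one above. The index `k` controls both the mesh and the truncation;
  -- `hi` also carries the tail.
  set lo : ℕ → ℝ → ℝ := fun k => ∑ s ∈ Finset.range k,
    (1 / h k) • (r (a * (s + 1)) - r (a * (s + 1) + h k)) with hlo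
  set hi : ℕ → ℝ → ℝ := fun k => ∑ s ∈ Finset.range k,
    (1 / h k) • (r (a * (s + 1) - h k) - r (a * (s + 1))) + (1 / a) • r (a * k) with hhi
  set q := Real.exp (-(lam * a)) with hq
  have hq1 : q < 1 := by rw [hq, Real.exp_lt_one_iff]; nlinarith
  have hq0 : 0 < q := Real.exp_pos _
  have hexp : ∀ s : ℕ, Real.exp (-(lam * (a * (s + 1)))) = q * q ^ s := by
    intro s
    rw [hq, ← Real.exp_nat_mul, ← Real.exp_add]; congr 1; ring
  have hh0 : Tendsto h atTop (𝓝[>] 0) := by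
    refine tendsto_nhdsWithin_iff.2 ⟨?_, Eventually.of_forall hpos⟩
    refine Tendsto.div_atTop tendsto_const_nhds ?_
    exact tendsto_atTop_add_const_right _ _ tendsto_natCast_atTop_atTop
  -- Used with `b = -lam` for the lower bound and `b = lam` for the upper one; both quotients
  -- produce the factor `lam` in front of the geometric series.
  have hslope : ∀ b : ℝ, Tendsto (fun k => 1 / h k * (Real.exp (b * h k) - 1)) atTop (𝓝 b) := by
    intro b
    have hd : HasDerivAt (fun x : ℝ => Real.exp (b * x)) b 0 := by
      have := ((hasDerivAt_id (0 : ℝ)).const_mul b).exp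
      simpa using this
    have := (hasDerivAt_iff_tendsto_slope.1 hd).comp
      (hh0.mono_right (nhdsWithin_mono _ (fun x hx => (ne_of_gt hx : x ≠ 0))))
    refine this.congr fun k => ?_
    simp [slope_def_field, div_eq_inv_mul]
  have hgeom : Tendsto (fun k => ∑ s ∈ Finset.range k, q * q ^ s) atTop (𝓝 (q * (1 - q)⁻¹)) :=
    ((hasSum_geometric_of_lt_one hq0.le hq1).mul_left q).tendsto_sum_nat
  have hval : lam * (q * (1 - q)⁻¹) = lam / (Real.exp (lam * a) - 1) := by
    have : Real.exp (lam * a) = q⁻¹ := by rw [hq, Real.exp_neg, inv_inv]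
    rw [this]
    have : 1 - q ≠ 0 := by linarith
    have : q⁻¹ - 1 ≠ 0 := by
      have := (one_lt_inv₀ hq0).2 hq1
      linarith
    field_simp
  refine tendsto_of_squeeze_family (m := atTop) (lo := fun k i => A i (lo k))
    (hi := fun k i => A i (hi k))
    (lo' := fun k => ∑ s ∈ Finset.range k, (1 / h k) *
      (Real.exp (-(lam * (a * (s + 1)))) - Real.exp (-(lam * (a * (s + 1) + h k)))))
    (hi' := fun k => ∑ s ∈ Finset.range k, (1 / h k) *
      (Real.exp (-(lam * (a * (s + 1) - h k))) - Real.exp (-(lam * (a * (s + 1)))))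
      + (1 / a) * Real.exp (-(lam * (a * k)))) ?_ ?_ ?_ ?_ ?_ ?_
  · refine Eventually.of_forall fun k => ?_
    simp only [hlo, map_sum, map_smul, map_sub, smul_eq_mul]
    refine tendsto_finsetSum _ fun s _ => Tendsto.const_mul _ (Tendsto.sub ?_ ?_)
    · exact hA _ (by positivity)
    · have := hpos k
      exact hA _ (by positivity)
  · filter_upwards [eventually_gt_atTop 0] with k hk
    simp only [hhi, map_add, map_sum, map_smul, map_sub, smul_eq_mul]
    refine Tendsto.add (tendsto_finsetSum _ fun s _ => Tendsto.const_mul _ (Tendsto.sub ?_ ?_))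
      (Tendsto.const_mul _ ?_)
    · refine hA _ ?_
      have := hlt k
      have : a * 1 ≤ a * ((s : ℝ) + 1) := by gcongr; simp
      linarith
    · exact hA _ (by positivity)
    · have : (0 : ℝ) < k := by exact_mod_cast hk
      exact hA _ (by positivity)
  · refine Eventually.of_forall fun k => hmono.mono fun i hi' => hi' _ _ fun ℓ _ => ?_
    refine le_trans ?_ (sum_ite_le_natFloor_div ha ℓ k)
    simp only [hlo, Finset.sum_apply, Pi.smul_apply, Pi.sub_apply, smul_eq_mul, hr]
    refine Finset.sum_le_sum fun s _ => ?_
    have hk := hpos k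
    split_ifs with hs
    · rw [one_div, inv_mul_le_iff₀ hk, max_eq_left (by linarith)]
      linarith [le_max_left (ℓ - (a * (s + 1) + h k)) 0]
    · rw [max_eq_right (by linarith), max_eq_right (by linarith)]; simp
  · refine Eventually.of_forall fun k => hmono.mono fun i hi' => hi' _ _ fun ℓ hℓ => ?_
    refine (natFloor_div_le_sum_ite ha hℓ k).trans ?_
    simp only [hhi, Finset.sum_apply, Pi.smul_apply, Pi.sub_apply, Pi.add_apply, smul_eq_mul, hr]
    gcongr with s _
    have hk := hpos k
    split_ifs with hs
    · rw [one_div, le_inv_mul_iff₀ hk, max_eq_left (by linarith), max_eq_left (by linarith)]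
      linarith
    · refine mul_nonneg (by positivity) (sub_nonneg.2 (max_le_max_right _ (by linarith)))
  · have := (hslope (-lam)).neg.mul hgeom
    rw [neg_neg, hval] at this
    refine this.congr fun k => ?_
    rw [Finset.mul_sum]
    refine Finset.sum_congr rfl fun s _ => ?_
    have : Real.exp (-(lam * (a * (s + 1) + h k))) = q * q ^ s * Real.exp (-lam * h k) := by
      rw [← hexp, ← Real.exp_add]; congr 1; ring
    rw [this, hexp]; ring
  · have h1 := (hslope lam).mul hgeom
    rw [hval] at h1
    have h2 : Tendsto (fun k : ℕ => 1 / a * Real.exp (-(lam * (a * k)))) atTop (𝓝 (1 / a * 0)) := by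
      refine Tendsto.const_mul _ (Real.tendsto_exp_neg_atTop_nhds_zero.comp ?_)
      exact (tendsto_natCast_atTop_atTop.const_mul_atTop ha).const_mul_atTop hlam
    have := h1.add h2
    rw [mul_zero, add_zero] at this
    refine this.congr fun k => ?_
    rw [Finset.mul_sum]
    congr 1
    refine Finset.sum_congr rfl fun s _ => ?_
    have : Real.exp (-(lam * (a * (s + 1) - h k))) = q * q ^ s * Real.exp (lam * h k) := by
      rw [← hexp, ← Real.exp_add]; congr 1; ring
    rw [this, hexp]; ring

/-- A family of configurations is regular along `l` if it is locally finite, the volumes are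
eventually nondegenerate, and the void fractions have the limits of a Poisson process. -/
structure HasPoissonVoids {ι : Type*} (l : Filter ι) (L : ι → ℝ) (X : ι → Set ℝ)
    (lam : ℝ) : Prop where
  length_pos : ∀ᶠ i in l, 0 < L i
  finite : ∀ i, (X i ∩ Set.Ioo (-(L i / 2)) (L i / 2)).Finite
  tendsto_void : ∀ x > 0,
    Tendsto (fun i => voidFraction (L i) (X i) x) l (𝓝 (Real.exp (-(lam * x))))

lemma HasPoissonVoids.tendsto_idsMeasure_Iic {ι : Type*} {l : Filter ι} {L : ι → ℝ}
    {X : ι → Set ℝ} {lam : ℝ} (h : HasPoissonVoids l L X lam) (hlam : 0 < lam) {t : ℝ}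
    (ht : 0 ≤ t) :
    Tendsto (fun i => idsMeasure (L i) (X i) (Set.Iic t)) l (𝓝 (ENNReal.ofReal (ids lam t))) := by
  -- At `t = 0` division by zero makes `ids lam 0` equal to `0`, and no eigenvalue is nonpositive.
  rcases ht.eq_or_lt with rfl | ht
  · simpa [idsMeasure_Iic_zero, ids] using tendsto_const_nhds
  have hfin : ∀ i, Finite (boxes (L i) (X i)) := fun i => boxes_finite (h.finite i)
  have hc := cc_pos
  have hst : 0 < √t := Real.sqrt_pos.2 ht
  have key := tendsto_average_natFloor (l := l) (A := fun i => boxAvg (L i) (X i))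
    (h.length_pos.mono fun i hi f g hfg => boxAvg_le_of_pos hi _ hfg) hlam
    (fun x hx => (h.tendsto_void x hx).congr' (h.length_pos.mono fun i hi =>
      voidFraction_eq_boxAvg hi (h.finite i) hx)) (a := cc / √t) (by positivity)
  have e : lam * (cc / √t) = cc * lam / √t := by ring
  rw [e] at key
  refine (ENNReal.tendsto_ofReal key).congr' (h.length_pos.mono fun i hi => ?_)
  exact (idsMeasure_Iic hi _ ht).symm

/-! ### The limiting density of states -/

lemma one_lt_exp_div_sqrt {lam E : ℝ} (hlam : 0 < lam) (hE : 0 < E) :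
    1 < Real.exp (cc * lam / √E) := by
  have := cc_pos
  have := Real.sqrt_pos.2 hE
  exact Real.one_lt_exp_iff.2 (by positivity)

lemma dos_pos {lam E : ℝ} (hlam : 0 < lam) (hE : 0 < E) : 0 < dos lam E := by
  have h1 := one_lt_exp_div_sqrt hlam hE
  have h2 : 0 < (Real.exp (cc * lam / √E) - 1) ^ 2 := by
    have : 0 < Real.exp (cc * lam / √E) - 1 := by linarith
    positivity
  have := cc_pos
  unfold dos
  positivity

lemma measurable_dos (lam : ℝ) : Measurable (dos lam) := by
  unfold dos; fun_prop

lemma measurable_bose (β μ : ℝ) : Measurable (bose β μ) := by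
  unfold bose; fun_prop

lemma hasDerivAt_ids {lam E : ℝ} (hlam : 0 < lam) (hE : 0 < E) :
    HasDerivAt (ids lam) (dos lam E) E := by
  have h1 := one_lt_exp_div_sqrt hlam hE
  have hs := Real.sqrt_pos.2 hE
  have hd := ((((Real.hasDerivAt_sqrt hE.ne').fun_inv hs.ne').const_mul (cc * lam)).exp.sub_const
    1).fun_inv (by rw [← div_eq_mul_inv]; linarith) |>.const_mul lam
  refine hd.congr_deriv ?_ |>.congr_of_eventuallyEq (Eventually.of_forall fun x => ?_)
  · have e : E ^ (3 / 2 : ℝ) = √E ^ 3 := by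
      rw [Real.sqrt_eq_rpow, ← Real.rpow_natCast, ← Real.rpow_mul hE.le]; norm_num
    unfold dos
    rw [e, ← div_eq_mul_inv]
    have : Real.exp (cc * lam / √E) - 1 ≠ 0 := by linarith
    field_simp
  · simp only [ids, div_eq_mul_inv]

lemma tendsto_ids_zero {lam : ℝ} (hlam : 0 < lam) : Tendsto (ids lam) (𝓝[>] 0) (𝓝 0) := by
  have h1 : Tendsto (fun E : ℝ => √E) (𝓝[>] 0) (𝓝[>] 0) := by
    refine tendsto_nhdsWithin_iff.2 ⟨?_, eventually_nhdsWithin_of_forall fun x hx =>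
      Real.sqrt_pos.2 hx⟩
    have := (Real.continuous_sqrt.tendsto 0).mono_left (nhdsWithin_le_nhds (s := Set.Ioi 0))
    rwa [Real.sqrt_zero] at this
  have h2 : Tendsto (fun E : ℝ => cc * lam / √E) (𝓝[>] 0) atTop := by
    simp only [div_eq_mul_inv]
    exact (tendsto_inv_nhdsGT_zero.comp h1).const_mul_atTop (mul_pos cc_pos hlam)
  exact Tendsto.div_atTop tendsto_const_nhds
    (tendsto_atTop_add_const_right _ (-1) (Real.tendsto_exp_atTop.comp h2))

/-- The default value at `0` agrees with the limit there, which lets the fundamental theorem of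
calculus start from `0`. -/
lemma continuousOn_ids {lam : ℝ} (hlam : 0 < lam) : ContinuousOn (ids lam) (Set.Ici 0) := by
  intro E hE
  rcases (Set.mem_Ici.1 hE).eq_or_lt with rfl | hE
  · rw [← continuousWithinAt_Ioi_iff_Ici, ContinuousWithinAt]
    simpa [ids] using tendsto_ids_zero hlam
  · exact (hasDerivAt_ids hlam hE).continuousAt.continuousWithinAt

lemma ids_pos {lam E : ℝ} (hlam : 0 < lam) (hE : 0 < E) : 0 < ids lam E :=
  div_pos hlam (by linarith [one_lt_exp_div_sqrt hlam hE])

/-- Integrability down to `0` needs no estimate: a nonnegative derivative of a function continuous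
up to the end points is integrable. -/
lemma lintegral_dos_Ioc {lam : ℝ} (hlam : 0 < lam) {ε t : ℝ} (hε : 0 ≤ ε) (ht : ε ≤ t) :
    ∫⁻ E in Set.Ioc ε t, ENNReal.ofReal (dos lam E) = ENNReal.ofReal (ids lam t - ids lam ε) := by
  have hc : ContinuousOn (ids lam) (Set.Icc ε t) :=
    (continuousOn_ids hlam).mono fun x hx => hε.trans hx.1
  have hd : ∀ x ∈ Set.Ioo ε t, HasDerivAt (ids lam) (dos lam x) x := fun x hx =>
    hasDerivAt_ids hlam (hε.trans_lt hx.1)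
  have hi : IntegrableOn (dos lam) (Set.Ioc ε t) :=
    intervalIntegral.integrableOn_deriv_of_nonneg hc hd fun x hx =>
      (dos_pos hlam (hε.trans_lt hx.1)).le
  rw [← intervalIntegral.integral_eq_sub_of_hasDerivAt_of_le ht hc hd
      ((intervalIntegrable_iff_integrableOn_Ioc_of_le ht).2 hi),
    intervalIntegral.integral_of_le ht, ofReal_integral_eq_lintegral_ofReal hi]
  filter_upwards [ae_restrict_mem measurableSet_Ioc] with x hx
  exact (dos_pos hlam (hε.trans_lt hx.1)).le

/-! ### Layer cake for the Bose function -/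

/-- Minus the derivative of the Bose function in the energy. -/
def negDerivBose (β μ t : ℝ) : ℝ := β * Real.exp (β * (t - μ)) / (Real.exp (β * (t - μ)) - 1) ^ 2

lemma exp_sub_one_pos {β μ t : ℝ} (hβ : 0 < β) (h : μ < t) : 0 < Real.exp (β * (t - μ)) - 1 := by
  have : 0 < β * (t - μ) := mul_pos hβ (by linarith)
  linarith [Real.one_lt_exp_iff.2 this]

lemma bose_pos {β μ E : ℝ} (hβ : 0 < β) (h : μ < E) : 0 < bose β μ E :=
  one_div_pos.2 (exp_sub_one_pos hβ h)

lemma bose_mono {β μ μ' E : ℝ} (hβ : 0 < β) (h : μ ≤ μ') (h' : μ' < E) :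
    bose β μ E ≤ bose β μ' E := by
  unfold bose
  refine one_div_le_one_div_of_le (exp_sub_one_pos hβ h') ?_
  gcongr

lemma bose_strictMono {β μ μ' E : ℝ} (hβ : 0 < β) (h : μ < μ') (h' : μ' < E) :
    bose β μ E < bose β μ' E := by
  unfold bose
  refine one_div_lt_one_div_of_lt (exp_sub_one_pos hβ h') ?_
  gcongr

lemma negDerivBose_nonneg {β : ℝ} (hβ : 0 < β) (μ t : ℝ) : 0 ≤ negDerivBose β μ t := by
  unfold negDerivBose; positivity

lemma measurable_negDerivBose (β μ : ℝ) : Measurable (negDerivBose β μ) := by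
  unfold negDerivBose; fun_prop

lemma hasDerivAt_bose {β μ t : ℝ} (hβ : 0 < β) (h : μ < t) :
    HasDerivAt (bose β μ) (-negDerivBose β μ t) t := by
  have h1 := exp_sub_one_pos hβ h
  have hd := ((((hasDerivAt_id t).sub_const μ).const_mul β).exp.sub_const 1).fun_inv h1.ne'
  refine hd.congr_deriv ?_ |>.congr_of_eventuallyEq (Eventually.of_forall fun x => ?_)
  · simp only [negDerivBose, id]; ring
  · simp only [bose, id, one_div]

lemma tendsto_bose_atTop {β : ℝ} (hβ : 0 < β) (μ : ℝ) : Tendsto (bose β μ) atTop (𝓝 0) := by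
  refine Tendsto.div_atTop tendsto_const_nhds
    (tendsto_atTop_add_const_right _ (-1) (Real.tendsto_exp_atTop.comp ?_))
  exact (tendsto_atTop_add_const_right _ (-μ) tendsto_id).const_mul_atTop hβ

lemma ofReal_bose_eq_lintegral {β μ E : ℝ} (hβ : 0 < β) (h : μ < E) :
    ENNReal.ofReal (bose β μ E) = ∫⁻ t in Set.Ioi E, ENNReal.ofReal (negDerivBose β μ t) := by
  have hc : ContinuousWithinAt (bose β μ) (Set.Ici E) E :=
    (hasDerivAt_bose hβ h).continuousAt.continuousWithinAt
  have hd : ∀ x ∈ Set.Ioi E, HasDerivAt (bose β μ) (-negDerivBose β μ x) x := fun x hx =>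
    hasDerivAt_bose hβ (h.trans hx)
  have hn : ∀ x ∈ Set.Ioi E, -negDerivBose β μ x ≤ 0 := fun x _ =>
    neg_nonpos.2 (negDerivBose_nonneg hβ μ x)
  have hI := (integrableOn_Ioi_deriv_of_nonpos hc hd hn (tendsto_bose_atTop hβ μ)).neg
  have hv := integral_Ioi_of_hasDerivAt_of_nonpos hc hd hn (tendsto_bose_atTop hβ μ)
  rw [integral_neg, zero_sub, neg_inj] at hv
  simp only [Pi.neg_def, neg_neg] at hI
  rw [← hv, ofReal_integral_eq_lintegral_ofReal hI]
  exact Eventually.of_forall fun t => negDerivBose_nonneg hβ μ t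

/-- Layer cake: the Bose function at `E` is the integral of `negDerivBose` over `(E, ∞)`, and
Tonelli exchanges the integrals. The measure then enters only through its values on `Ioc ε t`. -/
lemma lintegral_bose_eq {β μ ε : ℝ} (hβ : 0 < β) (h : μ ≤ ε) (m : Measure ℝ) [SFinite m] :
    ∫⁻ E in Set.Ioi ε, ENNReal.ofReal (bose β μ E) ∂m
      = ∫⁻ t in Set.Ioi ε, ENNReal.ofReal (negDerivBose β μ t) * m (Set.Ioc ε t) := by
  have hmeas : Measurable (fun t => ENNReal.ofReal (negDerivBose β μ t)) :=
    (measurable_negDerivBose β μ).ennreal_ofReal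
  calc _ = ∫⁻ E in Set.Ioi ε, (∫⁻ t in Set.Ioi ε,
        if E ≤ t then ENNReal.ofReal (negDerivBose β μ t) else 0) ∂m := by
        refine setLIntegral_congr_fun measurableSet_Ioi fun E hE => ?_
        -- Adding the null point `t = E` turns the condition into `E ≤ t`, so the inner integral
        -- will give intervals closed on the right.
        rw [ofReal_bose_eq_lintegral hβ (h.trans_lt hE), ← setLIntegral_congr Ioi_ae_eq_Ici.symm]
        have : Set.Ici E = Set.Ici E ∩ Set.Ioi ε := by
          rw [Set.inter_eq_left.2]
          exact fun t ht => (Set.mem_Ioi.1 hE).trans_le ht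
        rw [this, ← Measure.restrict_restrict measurableSet_Ici,
          ← lintegral_indicator measurableSet_Ici]
        rfl
    _ = ∫⁻ t in Set.Ioi ε, (∫⁻ E in Set.Ioi ε,
        (if E ≤ t then ENNReal.ofReal (negDerivBose β μ t) else 0) ∂m) := by
        refine lintegral_lintegral_swap (Measurable.aemeasurable ?_)
        exact Measurable.ite (measurableSet_le measurable_fst measurable_snd)
          (hmeas.comp measurable_snd) measurable_const
    _ = _ := by
        refine lintegral_congr fun t => ?_
        have : ∀ E, (if E ≤ t then ENNReal.ofReal (negDerivBose β μ t) else 0)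
            = (Set.Iic t).indicator (fun _ => ENNReal.ofReal (negDerivBose β μ t)) E :=
          fun E => rfl
        simp only [this]
        rw [lintegral_indicator_const measurableSet_Iic, Measure.restrict_apply measurableSet_Iic,
          Set.inter_comm, Set.Ioi_inter_Iic]

/-! ### Convergence of the density of particles above a given energy -/

/-- With `y = exp (-(β (t - μ)))` the left side is `β y / (1 - y)²`. The gap between `ν` and `ε`
keeps `y` away from `1`, uniformly in `μ ≤ ν` and `t > ε`. -/
lemma negDerivBose_le {β μ ν ε t : ℝ} (hβ : 0 < β) (hμ : μ ≤ ν) (hν : ν < ε) (ht : ε < t) :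
    negDerivBose β μ t
      ≤ β * Real.exp (β * ν) / (1 - Real.exp (-(β * (ε - ν)))) ^ 2 * Real.exp (-(β * t)) := by
  have h0 : 0 < 1 - Real.exp (-(β * (ε - ν))) := by
    have : -(β * (ε - ν)) < 0 := by nlinarith
    linarith [Real.exp_lt_one_iff.2 this]
  have h1 : Real.exp (-(β * (t - μ))) ≤ Real.exp (-(β * (ε - ν))) := by
    rw [Real.exp_le_exp]; nlinarith
  have e : negDerivBose β μ t
      = β * Real.exp (-(β * (t - μ))) / (1 - Real.exp (-(β * (t - μ)))) ^ 2 := by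
    have := exp_sub_one_pos hβ (hμ.trans_lt (hν.trans ht))
    unfold negDerivBose
    rw [Real.exp_neg]
    have : Real.exp (β * (t - μ)) ≠ 0 := (Real.exp_pos _).ne'
    have : 1 - (Real.exp (β * (t - μ)))⁻¹ ≠ 0 := by
      rw [sub_ne_zero, ne_comm, inv_ne_one]; linarith
    field_simp
  rw [e]
  have h2 : Real.exp (-(β * (t - μ))) ≤ Real.exp (β * ν) * Real.exp (-(β * t)) := by
    rw [← Real.exp_add, Real.exp_le_exp]; nlinarith
  calc _ ≤ β * (Real.exp (β * ν) * Real.exp (-(β * t)))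
        / (1 - Real.exp (-(β * (ε - ν)))) ^ 2 := by gcongr
    _ = _ := by ring

lemma integrableOn_sqrt_mul_exp {β : ℝ} (hβ : 0 < β) :
    IntegrableOn (fun t => √t * Real.exp (-(β * t))) (Set.Ioi 0) := by
  have := integrableOn_rpow_mul_exp_neg_mul_rpow (p := 1) (s := 1 / 2) (b := β) (by norm_num)
    one_pos hβ
  simpa [Real.sqrt_eq_rpow] using this

lemma continuousAt_negDerivBose {β μ t : ℝ} (hβ : 0 < β) (h : μ < t) :
    ContinuousAt (fun μ => negDerivBose β μ t) μ := by
  unfold negDerivBose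
  refine ContinuousAt.div (by fun_prop) (by fun_prop) ?_
  exact pow_ne_zero _ (exp_sub_one_pos hβ h).ne'

instance (L : ℝ) (X : Set ℝ) [Finite (boxes L X)] : SFinite (idsMeasure L X) := by
  unfold idsMeasure; infer_instance

lemma HasPoissonVoids.tendsto_idsMeasure_Ioc {ι : Type*} {l : Filter ι} {L : ι → ℝ}
    {X : ι → Set ℝ} {lam : ℝ} (h : HasPoissonVoids l L X lam) (hlam : 0 < lam) {ε t : ℝ}
    (hε : 0 ≤ ε) (ht : ε < t) :
    Tendsto (fun i => idsMeasure (L i) (X i) (Set.Ioc ε t)) l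
      (𝓝 (ENNReal.ofReal (ids lam t - ids lam ε))) := by
  rw [ENNReal.ofReal_sub _ (by
    rcases hε.eq_or_lt with rfl | hε
    · simp [ids]
    · exact (ids_pos hlam hε).le)]
  refine (ENNReal.Tendsto.sub (h.tendsto_idsMeasure_Iic hlam (hε.trans ht.le))
    (h.tendsto_idsMeasure_Iic hlam hε) (Or.inl ENNReal.ofReal_ne_top)).congr'
    (h.length_pos.mono fun i hi => ?_)
  have e : Set.Ioc ε t = Set.Iic t \ Set.Iic ε := by
    ext x; simp [and_comm]
  simp only
  rw [e, measure_sdiff (Set.Iic_subset_Iic.2 ht.le)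
    measurableSet_Iic.nullMeasurableSet]
  refine ne_top_of_le_ne_top ENNReal.ofReal_ne_top ((measure_mono
    (Set.Iic_subset_Iic.2 ht.le)).trans (idsMeasure_Iic_le hi (h.finite i) (hε.trans_lt ht)))

/-- After `lintegral_bose_eq` on both sides, this is dominated convergence in `t`. It is used with
`ε = 0` at fixed negative potentials, and with `ε > 0` along the solutions, even when these tend to
`0`. -/
lemma HasPoissonVoids.tendsto_lintegral_bose {ι : Type*} {l : Filter ι} [l.IsCountablyGenerated]
    {L : ι → ℝ} {X : ι → Set ℝ} {lam β : ℝ} (h : HasPoissonVoids l L X lam) (hlam : 0 < lam)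
    (hβ : 0 < β) {ε : ℝ} (hε : 0 ≤ ε) {μ : ι → ℝ} {μ₀ : ℝ} (hμ : Tendsto μ l (𝓝 μ₀))
    (hμε : μ₀ < ε) :
    Tendsto (fun i => ∫⁻ E in Set.Ioi ε, ENNReal.ofReal (bose β (μ i) E) ∂idsMeasure (L i) (X i)) l
      (𝓝 (∫⁻ E in Set.Ioi ε, ENNReal.ofReal (dos lam E * bose β μ₀ E))) := by
  have hfin : ∀ i, Finite (boxes (L i) (X i)) := fun i => boxes_finite (h.finite i)
  set D := (volume : Measure ℝ).withDensity fun E => ENNReal.ofReal (dos lam E) with hD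
  have hlim : ∫⁻ E in Set.Ioi ε, ENNReal.ofReal (dos lam E * bose β μ₀ E)
      = ∫⁻ t in Set.Ioi ε, ENNReal.ofReal (negDerivBose β μ₀ t)
        * ENNReal.ofReal (ids lam t - ids lam ε) := by
    have e1 := lintegral_bose_eq hβ hμε.le D
    rw [hD, setLIntegral_withDensity_eq_setLIntegral_mul _ (measurable_dos lam).ennreal_ofReal
      (measurable_bose β μ₀).ennreal_ofReal measurableSet_Ioi] at e1
    calc _ = _ := by
          refine setLIntegral_congr_fun measurableSet_Ioi fun E hE => ?_
          exact ENNReal.ofReal_mul (dos_pos hlam (hε.trans_lt hE)).le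
      _ = _ := e1
      _ = _ := by
          refine setLIntegral_congr_fun measurableSet_Ioi fun t ht => ?_
          rw [withDensity_apply _ measurableSet_Ioc,
            lintegral_dos_Ioc hlam hε (Set.mem_Ioi.1 ht).le]
  rw [hlim]
  obtain ⟨ν, hν1, hν2⟩ := exists_between hμε
  have hev : ∀ᶠ i in l, μ i ≤ ν := (hμ.eventually (gt_mem_nhds hν1)).mono fun _ h => h.le
  refine Tendsto.congr' (f₁ := fun i => ∫⁻ t in Set.Ioi ε, ENNReal.ofReal (negDerivBose β (μ i) t)
        * idsMeasure (L i) (X i) (Set.Ioc ε t)) (hev.mono fun i hi =>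
    (lintegral_bose_eq hβ (hi.trans hν2.le) _).symm) ?_
  set C := β * Real.exp (β * ν) / (1 - Real.exp (-(β * (ε - ν)))) ^ 2 with hC
  have hC0 : 0 ≤ C := by positivity
  refine tendsto_lintegral_filter_of_dominated_convergence
    (fun t => ENNReal.ofReal (C / cc * (√t * Real.exp (-(β * t))))) ?_ ?_ ?_ ?_
  · refine Eventually.of_forall fun i => ?_
    refine (measurable_negDerivBose β _).ennreal_ofReal.mul (Monotone.measurable fun s t hst => ?_)
    exact measure_mono (Set.Ioc_subset_Ioc_right hst)
  · filter_upwards [hev, h.length_pos] with i hi hL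
    filter_upwards [ae_restrict_mem measurableSet_Ioi] with t ht
    have ht' : ε < t := ht
    calc _ ≤ ENNReal.ofReal (C * Real.exp (-(β * t))) * ENNReal.ofReal (√t / cc) := by
          gcongr
          · exact negDerivBose_le hβ hi hν2 ht'
          · exact (measure_mono fun x hx => hx.2).trans
              (idsMeasure_Iic_le hL (h.finite i) (hε.trans_lt ht'))
      _ = _ := by
          rw [← ENNReal.ofReal_mul (by positivity)]
          congr 1; ring
  · have := ((integrableOn_sqrt_mul_exp hβ).mono_set (Set.Ioi_subset_Ioi hε)).const_mul (C / cc)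
    exact this.lintegral_lt_top.ne
  · filter_upwards [ae_restrict_mem measurableSet_Ioi] with t ht
    have ht' : ε < t := ht
    refine ENNReal.Tendsto.mul ?_ (Or.inr ENNReal.ofReal_ne_top)
      (h.tendsto_idsMeasure_Ioc hlam hε ht') (Or.inr ENNReal.ofReal_ne_top)
    exact ENNReal.tendsto_ofReal
      ((continuousAt_negDerivBose hβ (hμε.trans ht')).tendsto.comp hμ)

/-! ### The limiting particle density -/

lemma exp_sub_one_eq (u : ℝ) : Real.exp u - 1 = Real.exp (u / 2) * (2 * Real.sinh (u / 2)) := by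
  have e : Real.exp u = Real.exp (u / 2) * Real.exp (u / 2) := by
    rw [← Real.exp_add]; congr 1; ring
  rw [Real.sinh_eq, mul_div_cancel₀ _ two_ne_zero, mul_sub, ← e, ← Real.exp_add]
  simp

/-- A power `E ^ (3 / 2)` suffices against the `1 / E` singularity of the Bose function at `μ = 0`.
With `u = cc * lam / √E`, `exp u / (exp u - 1)²` is `1 / (2 sinh (u / 2))²`, and tripling gives
`sinh (3 v) ≥ 4 v³` at `v = u / 6`, whence `729`. -/
lemma dos_le {lam E : ℝ} (hlam : 0 < lam) (hE : 0 < E) :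
    dos lam E ≤ lam ^ 2 * cc / 2 * (729 / (cc * lam) ^ 6) * √E ^ 3 := by
  have hc := cc_pos
  have hs := Real.sqrt_pos.2 hE
  set u := cc * lam / √E with hu
  have hu0 : 0 < u := by positivity
  have e : E ^ (3 / 2 : ℝ) = √E ^ 3 := by
    rw [Real.sqrt_eq_rpow, ← Real.rpow_natCast, ← Real.rpow_mul hE.le]; norm_num
  have h1 : 4 * (u / 6) ^ 3 ≤ Real.sinh (u / 2) := by
    have h2 : u / 6 ≤ Real.sinh (u / 6) := Real.self_le_sinh_iff.2 (by positivity)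
    have h3 : u / 2 = 3 * (u / 6) := by ring
    rw [h3, Real.sinh_three_mul]
    have h4 : (u / 6) ^ 3 ≤ Real.sinh (u / 6) ^ 3 := by gcongr
    have h5 : 0 ≤ u / 6 := by positivity
    linarith
  have h2 : Real.exp u / (Real.exp u - 1) ^ 2 ≤ 729 / u ^ 6 := by
    have e2 : Real.exp u = Real.exp (u / 2) ^ 2 := by
      rw [← Real.exp_nat_mul]; congr 1; push_cast; ring
    have hp := Real.exp_pos (u / 2)
    have : 0 < Real.sinh (u / 2) := lt_of_lt_of_le (by positivity) h1
    rw [exp_sub_one_eq, e2]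
    calc _ = 1 / (2 * Real.sinh (u / 2)) ^ 2 := by field_simp
      _ ≤ 1 / (2 * (4 * (u / 6) ^ 3)) ^ 2 := by gcongr
      _ = 729 / u ^ 6 := by field_simp; norm_num
  have hs0 : u ^ 6 = (cc * lam) ^ 6 / √E ^ 6 := by rw [hu, div_pow]
  calc dos lam E = lam ^ 2 * cc / 2 / √E ^ 3 * (Real.exp u / (Real.exp u - 1) ^ 2) := by
        unfold dos; rw [e, ← hu]; field_simp
    _ ≤ lam ^ 2 * cc / 2 / √E ^ 3 * (729 / u ^ 6) := by gcongr
    _ = _ := by rw [hs0]; field_simp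

lemma bose_zero_le {β E : ℝ} (hβ : 0 < β) (hE : 0 < E) :
    bose β 0 E ≤ 1 / (β * E) * Real.exp (-(β / 2 * E)) := by
  unfold bose
  rw [sub_zero, exp_sub_one_eq]
  have h0 : 0 < β * E := by positivity
  have h1 : β * E ≤ 2 * Real.sinh (β * E / 2) := by
    have := Real.self_le_sinh_iff.2 (show 0 ≤ β * E / 2 by positivity)
    linarith
  calc _ ≤ 1 / (Real.exp (β * E / 2) * (β * E)) := by gcongr
    _ = _ := by
      rw [show -(β / 2 * E) = -(β * E / 2) by ring, Real.exp_neg, one_div, one_div, mul_inv]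
      ring

/-- This is the finiteness of the critical density, and the integrand at `μ = 0` dominates those at
all `μ ≤ 0`. -/
lemma integrableOn_dos_mul_bose_zero {lam β : ℝ} (hlam : 0 < lam) (hβ : 0 < β) :
    IntegrableOn (fun E => dos lam E * bose β 0 E) (Set.Ioi 0) := by
  set C := lam ^ 2 * cc / 2 * (729 / (cc * lam) ^ 6) with hC
  have hc := cc_pos
  have hC0 : 0 < C := by positivity
  refine ((integrableOn_sqrt_mul_exp (half_pos hβ)).const_mul (C / β)).mono'
    ((measurable_dos lam).mul (measurable_bose β 0)).aestronglyMeasurable ?_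
  filter_upwards [ae_restrict_mem measurableSet_Ioi] with E hE
  have hE : 0 < E := hE
  have hs := Real.sqrt_pos.2 hE
  have h1 := dos_pos hlam hE
  have h2 := bose_pos hβ hE
  rw [Real.norm_of_nonneg (by positivity)]
  calc _ ≤ (C * √E ^ 3) * (1 / (β * E) * Real.exp (-(β / 2 * E))) := by
        gcongr
        · exact dos_le hlam hE
        · exact bose_zero_le hβ hE
    _ = _ := by
        nth_rw 2 [← Real.sq_sqrt hE.le]
        field_simp

lemma dos_mul_bose_nonneg {lam β μ E : ℝ} (hlam : 0 < lam) (hβ : 0 < β) (hμ : μ ≤ 0) (hE : 0 < E) :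
    0 ≤ dos lam E * bose β μ E :=
  (mul_pos (dos_pos hlam hE) (bose_pos hβ (hμ.trans_lt hE))).le

lemma norm_dos_mul_bose_le {lam β μ E : ℝ} (hlam : 0 < lam) (hβ : 0 < β) (hμ : μ ≤ 0)
    (hE : 0 < E) : ‖dos lam E * bose β μ E‖ ≤ dos lam E * bose β 0 E := by
  rw [Real.norm_of_nonneg (dos_mul_bose_nonneg hlam hβ hμ hE)]
  exact mul_le_mul_of_nonneg_left (bose_mono hβ hμ hE) (dos_pos hlam hE).le

lemma integrableOn_dos_mul_bose {lam β μ : ℝ} (hlam : 0 < lam) (hβ : 0 < β) (hμ : μ ≤ 0) :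
    IntegrableOn (fun E => dos lam E * bose β μ E) (Set.Ioi 0) := by
  refine (integrableOn_dos_mul_bose_zero hlam hβ).mono'
    ((measurable_dos lam).mul (measurable_bose β μ)).aestronglyMeasurable ?_
  filter_upwards [ae_restrict_mem measurableSet_Ioi] with E hE
    using norm_dos_mul_bose_le hlam hβ hμ hE

lemma lintegral_dos_mul_bose {lam β μ ε : ℝ} (hlam : 0 < lam) (hβ : 0 < β) (hμ : μ ≤ 0)
    (hε : 0 ≤ ε) :
    ∫⁻ E in Set.Ioi ε, ENNReal.ofReal (dos lam E * bose β μ E)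
      = ENNReal.ofReal (∫ E in Set.Ioi ε, dos lam E * bose β μ E) := by
  rw [ofReal_integral_eq_lintegral_ofReal
    ((integrableOn_dos_mul_bose hlam hβ hμ).mono_set (Set.Ioi_subset_Ioi hε))]
  filter_upwards [ae_restrict_mem measurableSet_Ioi] with E hE
    using dos_mul_bose_nonneg hlam hβ hμ (hε.trans_lt hE)

lemma continuousAt_bose {β μ E : ℝ} (hβ : 0 < β) (h : μ < E) :
    ContinuousAt (fun μ => bose β μ E) μ := by
  unfold bose
  exact ContinuousAt.div (by fun_prop) (by fun_prop) (exp_sub_one_pos hβ h).ne'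

lemma continuousOn_rho {lam β : ℝ} (hlam : 0 < lam) (hβ : 0 < β) :
    ContinuousOn (rho lam β) (Set.Iic 0) := by
  intro μ₀ hμ₀
  refine continuousWithinAt_of_dominated (bound := fun E => dos lam E * bose β 0 E) ?_ ?_
    (integrableOn_dos_mul_bose_zero hlam hβ) ?_
  · exact Eventually.of_forall fun μ =>
      ((measurable_dos lam).mul (measurable_bose β μ)).aestronglyMeasurable
  · filter_upwards [self_mem_nhdsWithin] with μ hμ
    filter_upwards [ae_restrict_mem measurableSet_Ioi] with E hE
      using norm_dos_mul_bose_le hlam hβ hμ hE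
  · filter_upwards [ae_restrict_mem measurableSet_Ioi] with E hE
    exact ((continuousAt_bose hβ ((Set.mem_Iic.1 hμ₀).trans_lt hE)).const_mul
      _).continuousWithinAt

lemma tendsto_rho_atBot {lam β : ℝ} (hlam : 0 < lam) (hβ : 0 < β) :
    Tendsto (rho lam β) atBot (𝓝 0) := by
  have h0 : (0 : ℝ) = ∫ E in Set.Ioi (0 : ℝ), dos lam E * 0 := by simp
  rw [h0]
  refine tendsto_integral_filter_of_dominated_convergence (fun E => dos lam E * bose β 0 E) ?_ ?_
    (integrableOn_dos_mul_bose_zero hlam hβ) ?_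
  · exact Eventually.of_forall fun μ =>
      ((measurable_dos lam).mul (measurable_bose β μ)).aestronglyMeasurable
  · filter_upwards [eventually_le_atBot 0] with μ hμ
    filter_upwards [ae_restrict_mem measurableSet_Ioi] with E hE
      using norm_dos_mul_bose_le hlam hβ hμ hE
  · refine Eventually.of_forall fun E => Tendsto.const_mul _ ?_
    refine Tendsto.div_atTop tendsto_const_nhds
      (tendsto_atTop_add_const_right _ (-1) (Real.tendsto_exp_atTop.comp ?_))
    refine Tendsto.const_mul_atTop hβ ?_
    exact tendsto_atTop_add_const_left _ E tendsto_neg_atBot_atTop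

lemma strictMonoOn_rho {lam β : ℝ} (hlam : 0 < lam) (hβ : 0 < β) :
    StrictMonoOn (rho lam β) (Set.Iic 0) := by
  intro μ hμ μ' hμ' h
  have hμ : μ ≤ 0 := hμ
  have hμ' : μ' ≤ 0 := hμ'
  have hi := integrableOn_dos_mul_bose hlam hβ hμ
  have hi' := integrableOn_dos_mul_bose hlam hβ hμ'
  have hpos : ∀ E ∈ Set.Ioi (0 : ℝ), 0 < dos lam E * bose β μ' E - dos lam E * bose β μ E := by
    intro E hE
    have hE : 0 < E := hE
    exact sub_pos.2 (mul_lt_mul_of_pos_left (bose_strictMono hβ h (hμ'.trans_lt hE))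
      (dos_pos hlam hE))
  rw [← sub_pos, rho, rho, ← integral_sub hi' hi, setIntegral_pos_iff_support_of_nonneg_ae]
  · have : Set.Ioi 0 ⊆ Function.support
        fun E => dos lam E * bose β μ' E - dos lam E * bose β μ E := fun E hE => (hpos E hE).ne'
    rw [Set.inter_eq_right.2 this]
    simp
  · filter_upwards [ae_restrict_mem measurableSet_Ioi] with E hE using (hpos E hE).le
  · exact hi'.sub hi

lemma tendsto_rho_zero {lam β : ℝ} (hlam : 0 < lam) (hβ : 0 < β) :
    Tendsto (fun μ => rho lam β μ) (𝓝[<] (0 : ℝ)) (𝓝 (rho lam β 0)) :=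
  (continuousOn_rho hlam hβ 0 Set.self_mem_Iic).mono_left (nhdsWithin_mono _ Set.Iio_subset_Iic_self)

/-- Continuity of `rho` up to the end point `0` replaces the limit by a value. -/
lemma rhoCrit_eq {lam β : ℝ} (hlam : 0 < lam) (hβ : 0 < β) : rhoCrit lam β = rho lam β 0 :=
  (tendsto_rho_zero hlam hβ).limUnder_eq

lemma exists_rho_eq {lam β ρ : ℝ} (hlam : 0 < lam) (hβ : 0 < β) (hρ : 0 < ρ)
    (h : ρ < rho lam β 0) : ∃ μ < 0, rho lam β μ = ρ := by
  obtain ⟨a, ha1, ha2⟩ := (((tendsto_rho_atBot hlam hβ).eventually (gt_mem_nhds hρ)).and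
    (eventually_lt_atBot 0)).exists
  obtain ⟨μ, hμ, hμρ⟩ := intermediate_value_Icc ha2.le ((continuousOn_rho hlam hβ).mono
    Set.Icc_subset_Iic_self) ⟨ha1.le, h.le⟩
  refine ⟨μ, lt_of_le_of_ne hμ.2 ?_, hμρ⟩
  rintro rfl
  exact h.ne' hμρ

lemma tendsto_setIntegral_dos_mul_bose {lam β μ : ℝ} (hlam : 0 < lam) (hβ : 0 < β) (hμ : μ ≤ 0) :
    Tendsto (fun ε => ∫ E in Set.Ioi ε, dos lam E * bose β μ E) (𝓝[>] 0) (𝓝 (rho lam β μ)) := by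
  have hcov : AECover (volume.restrict (Set.Ioi (0 : ℝ))) (𝓝[>] (0 : ℝ)) fun ε => Set.Ioi ε :=
    aecover_Ioi_of_Ioi (tendsto_id.mono_left nhdsWithin_le_nhds)
  refine (hcov.integral_tendsto_of_countably_generated
    (integrableOn_dos_mul_bose hlam hβ hμ)).congr' ?_
  filter_upwards [self_mem_nhdsWithin] with ε hε
  rw [Measure.restrict_restrict measurableSet_Ioi, Set.inter_eq_left.2]
  exact Set.Ioi_subset_Ioi (Set.mem_Ioi.1 hε).le

/-! ### The density equation in a finite volume -/

lemma energy_eq_sq_mul (s : ℕ) (ℓ : ℝ) : energy s ℓ = (s : ℝ) ^ 2 * energy 1 ℓ := by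
  unfold energy; push_cast; ring

lemma level_zero_le {L : ℝ} {X : Set ℝ} (p : boxes L X) (k : ℕ) :
    level L X (p, 0) ≤ level L X (p, k) := by
  have h : 0 < level L X (p, 0) := level_pos _
  have e : level L X (p, k) = ((k + 1 : ℕ) : ℝ) ^ 2 * level L X (p, 0) := energy_eq_sq_mul _ _
  rw [e]
  have : (1 : ℝ) ≤ ((k + 1 : ℕ) : ℝ) ^ 2 := one_le_pow₀ (by exact_mod_cast Nat.le_add_left 1 k)
  nlinarith

lemma summable_bose_level {L β m : ℝ} {X : Set ℝ} [Finite (boxes L X)] (hβ : 0 < β)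
    (hm : ∀ q, m < level L X q) : Summable fun q => 1 / L * bose β m (level L X q) := by
  refine Summable.mul_left _ ?_
  rw [summable_prod_of_nonneg fun q => (bose_pos hβ (hm q)).le]
  refine ⟨fun p => ?_, Summable.of_finite⟩
  have h1 : m < level L X (p, 0) := hm _
  have h2 : 0 < level L X (p, 0) := level_pos _
  -- With `max m 0` in place of `m`, the gap times `(k + 1)² ≥ 1` still bounds the gap of the `k`-th
  -- level from below, whatever the sign of `m`.
  set c := level L X (p, 0) - max m 0 with hc
  have hc0 : 0 < c := sub_pos.2 (max_lt h1 h2)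
  have hs : Summable fun k : ℕ => 1 / (β * c) * (1 / ((k + 1 : ℕ) : ℝ) ^ 2) :=
    ((summable_nat_add_iff 1).2 (Real.summable_one_div_nat_pow.2 one_lt_two)).mul_left _
  refine hs.of_nonneg_of_le (fun k => (bose_pos hβ (hm _)).le) fun k => ?_
  have e : level L X (p, k) = ((k + 1 : ℕ) : ℝ) ^ 2 * level L X (p, 0) := energy_eq_sq_mul _ _
  have h3 : (1 : ℝ) ≤ ((k + 1 : ℕ) : ℝ) ^ 2 := one_le_pow₀ (by exact_mod_cast Nat.le_add_left 1 k)
  set x := ((k + 1 : ℕ) : ℝ) ^ 2 with hx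
  have h4 : x * c ≤ level L X (p, k) - m := by
    rw [e, hc]
    nlinarith [le_max_left m 0, le_max_right m 0]
  have h5 : β * (x * c) ≤ β * (level L X (p, k) - m) := by gcongr
  have h6 := Real.add_one_le_exp (β * (level L X (p, k) - m))
  calc bose β m (level L X (p, k)) ≤ 1 / (β * (x * c)) := by
        unfold bose
        exact one_div_le_one_div_of_le (by positivity) (by linarith)
    _ = _ := by field_simp

/-- Lowering the potential shrinks all occupations by a common factor, which yields an explicit
potential of small density. -/
lemma bose_le_exp_mul {β a b E : ℝ} (hβ : 0 < β) (hab : a ≤ b) (hb : b < E) :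
    bose β a E ≤ Real.exp (-(β * (b - a))) * bose β b E := by
  have h1 := exp_sub_one_pos hβ hb
  have h2 : 1 ≤ Real.exp (β * (b - a)) := Real.one_le_exp (by nlinarith)
  have e : Real.exp (β * (E - a)) = Real.exp (β * (b - a)) * Real.exp (β * (E - b)) := by
    rw [← Real.exp_add]; congr 1; ring
  unfold bose
  rw [Real.exp_neg, ← one_div, one_div_mul_one_div]
  refine one_div_le_one_div_of_le (by positivity) ?_
  rw [e]; nlinarith

lemma exists_min_level {L : ℝ} {X : Set ℝ} [Finite (boxes L X)] [Nonempty (boxes L X)] :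
    ∃ q₀, ∀ q, level L X q₀ ≤ level L X q := by
  obtain ⟨p, hp⟩ := Finite.exists_min fun p : boxes L X => level L X (p, 0)
  exact ⟨(p, 0), fun q => (hp q.1).trans (level_zero_le _ _)⟩

/-- The density is continuous and strictly increasing below the lowest level; the intermediate value
theorem is applied between explicit potentials `a ≤ b`. -/
theorem existsUnique_solvesDensityEq {L β ρ : ℝ} {X : Set ℝ} (hL : 0 < L) (hβ : 0 < β)
    (hρ : 0 < ρ) (h : (X ∩ Set.Ioo (-(L / 2)) (L / 2)).Finite) :
    ∃! m : ℝ, SolvesDensityEq L X β ρ m := by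
  have : Finite (boxes L X) := boxes_finite h
  have : Nonempty (boxes L X) := (boxes_nonempty hL h).to_subtype
  obtain ⟨q₀, hq₀⟩ := exists_min_level (L := L) (X := X)
  set E₀ := level L X q₀ with hE₀
  set S : ℝ → ℝ := fun m => ∑' q, 1 / L * bose β m (level L X q) with hS
  have hsum : ∀ m < E₀, Summable fun q => 1 / L * bose β m (level L X q) := fun m hm =>
    summable_bose_level hβ fun q => hm.trans_le (hq₀ q)
  have hterm : ∀ m < E₀, ∀ q, 0 ≤ 1 / L * bose β m (level L X q) := fun m hm q =>
    mul_nonneg (by positivity) (bose_pos hβ (hm.trans_le (hq₀ q))).le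
  refine existsUnique_of_exists_of_unique ?_ ?_
  · have hx : 1 < 1 + 1 / (ρ * L) := by
      have : 0 < 1 / (ρ * L) := by positivity
      linarith
    -- At `b` the lowest level alone already has density `ρ`.
    set b := E₀ - Real.log (1 + 1 / (ρ * L)) / β with hb
    have hbE : b < E₀ := by
      have := div_pos (Real.log_pos hx) hβ
      linarith
    have hSb : ρ ≤ S b := by
      refine le_trans (le_of_eq ?_) ((hsum b hbE).le_tsum q₀ fun q _ => hterm b hbE q)
      have : β * (E₀ - b) = Real.log (1 + 1 / (ρ * L)) := by rw [hb]; field_simp; ring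
      rw [bose, ← hE₀, this, Real.exp_log (by linarith)]
      field_simp
      ring
    -- The factor `exp (-(β (b - a)))` from `bose_le_exp_mul` is then `ρ / S b`.
    set a := b - Real.log (S b / ρ) / β with ha
    have hSb0 : 0 < S b := hρ.trans_le hSb
    have hab : a ≤ b := by
      have := div_nonneg (Real.log_nonneg ((one_le_div hρ).2 hSb)) hβ.le
      linarith
    have hSa : S a ≤ ρ := by
      have h1 : S a ≤ ∑' q, Real.exp (-(β * (b - a))) * (1 / L * bose β b (level L X q)) := by
        refine (hsum a (hab.trans_lt hbE)).tsum_le_tsum (fun q => ?_) ((hsum b hbE).mul_left _)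
        rw [mul_left_comm]
        exact mul_le_mul_of_nonneg_left (bose_le_exp_mul hβ hab (hbE.trans_le (hq₀ q)))
          (by positivity)
      rw [tsum_mul_left] at h1
      refine h1.trans_eq ?_
      have : β * (b - a) = Real.log (S b / ρ) := by rw [ha]; field_simp; ring
      rw [this, Real.exp_neg, Real.exp_log (by positivity)]
      change (S b / ρ)⁻¹ * S b = ρ
      field_simp
    have hcont : ContinuousOn S (Set.Icc a b) := by
      refine continuousOn_tsum (fun q m hm => ?_) (hsum b hbE) fun q m hm => ?_
      · have : m < level L X q := hm.2.trans_lt (hbE.trans_le (hq₀ q))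
        exact ((continuousAt_bose hβ this).const_mul _).continuousWithinAt
      · rw [Real.norm_of_nonneg (hterm m (hm.2.trans_lt hbE) q)]
        exact mul_le_mul_of_nonneg_left (bose_mono hβ hm.2 (hbE.trans_le (hq₀ q)))
          (by positivity)
    obtain ⟨m, hm, hmρ⟩ := intermediate_value_Icc hab hcont ⟨hSa, hSb⟩
    have hmE : m < E₀ := hm.2.trans_lt hbE
    exact ⟨m, fun q => hmE.trans_le (hq₀ q), hmρ ▸ (hsum m hmE).hasSum⟩
  · have key : ∀ m m', m < m' → SolvesDensityEq L X β ρ m → SolvesDensityEq L X β ρ m' → False := by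
      intro m m' hmm h1 h2
      have hlt : ∀ q, 1 / L * bose β m (level L X q) < 1 / L * bose β m' (level L X q) := fun q =>
        mul_lt_mul_of_pos_left (bose_strictMono hβ hmm (h2.1 q)) (by positivity)
      exact lt_irrefl _ (hasSum_lt (fun q => (hlt q).le) (hlt q₀) h1.2 h2.2)
    intro m m' h1 h2
    rcases lt_trichotomy m m' with hlt | heq | hlt
    · exact (key m m' hlt h1 h2).elim
    · exact heq
    · exact (key m' m hlt h2 h1).elim

lemma lintegral_Ioi_bose_idsMeasure (L : ℝ) (X : Set ℝ) (β μ : ℝ) :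
    ∫⁻ E in Set.Ioi 0, ENNReal.ofReal (bose β μ E) ∂idsMeasure L X
      = ENNReal.ofReal (1 / L) * ∑' q, ENNReal.ofReal (bose β μ (level L X q)) := by
  rw [← lintegral_indicator measurableSet_Ioi,
    lintegral_idsMeasure ((measurable_bose β μ).ennreal_ofReal.indicator measurableSet_Ioi)]
  congr 1
  refine tsum_congr fun q => ?_
  exact Set.indicator_of_mem (Set.mem_Ioi.2 (level_pos q)) _

lemma SolvesDensityEq.lintegral_eq {L β ρ μ : ℝ} {X : Set ℝ} (h : SolvesDensityEq L X β ρ μ)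
    (hL : 0 < L) (hβ : 0 < β) :
    ∫⁻ E in Set.Ioi 0, ENNReal.ofReal (bose β μ E) ∂idsMeasure L X = ENNReal.ofReal ρ := by
  rw [lintegral_Ioi_bose_idsMeasure, ← h.2.tsum_eq, ← ENNReal.tsum_mul_left,
    ENNReal.ofReal_tsum_of_nonneg _ h.2.summable]
  · exact tsum_congr fun q => (ENNReal.ofReal_mul (by positivity)).symm
  · exact fun q => mul_nonneg (by positivity) (bose_pos hβ (h.1 q)).le

lemma SolvesDensityEq.lintegral_le {L β ρ μ ν : ℝ} {X : Set ℝ} (h : SolvesDensityEq L X β ρ μ)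
    (hL : 0 < L) (hβ : 0 < β) (hν : ν ≤ μ) :
    ∫⁻ E in Set.Ioi 0, ENNReal.ofReal (bose β ν E) ∂idsMeasure L X ≤ ENNReal.ofReal ρ := by
  rw [← h.lintegral_eq hL hβ, lintegral_Ioi_bose_idsMeasure, lintegral_Ioi_bose_idsMeasure]
  gcongr with q
  exact bose_mono hβ hν (h.1 q)

lemma SolvesDensityEq.le_lintegral {L β ρ μ ν : ℝ} {X : Set ℝ} (h : SolvesDensityEq L X β ρ μ)
    (hL : 0 < L) (hβ : 0 < β) (hν : μ ≤ ν) (hν0 : ν ≤ 0) :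
    ENNReal.ofReal ρ ≤ ∫⁻ E in Set.Ioi 0, ENNReal.ofReal (bose β ν E) ∂idsMeasure L X := by
  rw [← h.lintegral_eq hL hβ, lintegral_Ioi_bose_idsMeasure, lintegral_Ioi_bose_idsMeasure]
  gcongr with q
  exact bose_mono hβ hν (hν0.trans_lt (level_pos q))

lemma SolvesDensityEq.ae_lt {L β ρ μ : ℝ} {X : Set ℝ} (h : SolvesDensityEq L X β ρ μ) :
    ∀ᵐ E ∂idsMeasure L X, μ < E := by
  rw [ae_iff]
  have : {E : ℝ | ¬ μ < E} = Set.Iic μ := by ext; simp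
  rw [this, idsMeasure_apply measurableSet_Iic]
  simp [Set.indicator, (h.1 _).not_ge]

/-- The total is `ρ`, so the low energies are reached through their complement and never have to be
estimated directly. -/
lemma SolvesDensityEq.lowEnergyDensity_eq {L β ρ μ ε : ℝ} {X : Set ℝ}
    (h : SolvesDensityEq L X β ρ μ) (hL : 0 < L) (hβ : 0 < β) (hρ : 0 ≤ ρ) (hε : 0 < ε) :
    lowEnergyDensity L X β μ ε
      = ρ - (∫⁻ E in Set.Ioi ε, ENNReal.ofReal (bose β μ E) ∂idsMeasure L X).toReal := by
  have htot := h.lintegral_eq hL hβ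
  rw [← Set.Ioc_union_Ioi_eq_Ioi hε.le, lintegral_union measurableSet_Ioi
    (Set.disjoint_left.2 fun x hx hx' => not_lt.2 hx.2 hx')] at htot
  have hfin : ∀ a b : ENNReal, a + b = ENNReal.ofReal ρ → a.toReal = ρ - b.toReal := by
    intro a b hab
    have hne : a + b ≠ ⊤ := by rw [hab]; exact ENNReal.ofReal_ne_top
    have := congrArg ENNReal.toReal hab
    rw [ENNReal.toReal_add (ENNReal.add_ne_top.1 hne).1 (ENNReal.add_ne_top.1 hne).2,
      ENNReal.toReal_ofReal hρ] at this
    linarith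
  rw [← hfin _ _ htot, lowEnergyDensity, integral_eq_lintegral_of_nonneg_ae]
  · filter_upwards [ae_restrict_of_ae h.ae_lt] with E hE using (bose_pos hβ hE).le
  · exact (measurable_bose β μ).aestronglyMeasurable

/-! ### Asymptotics of the chemical potential for a fixed configuration -/

/-- A solution `μ i ≥ t` would leave no eigenvalue in `Iic t`, whereas the count there tends to a
positive limit. -/
lemma HasPoissonVoids.eventually_lt_of_pos {ι : Type*} {l : Filter ι} {L : ι → ℝ}
    {X : ι → Set ℝ} {lam β ρ : ℝ} (h : HasPoissonVoids l L X lam) (hlam : 0 < lam) {μ : ι → ℝ}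
    (hμ : ∀ᶠ i in l, SolvesDensityEq (L i) (X i) β ρ (μ i)) {t : ℝ} (ht : 0 < t) :
    ∀ᶠ i in l, μ i < t := by
  filter_upwards [hμ, (h.tendsto_idsMeasure_Iic hlam ht.le).eventually
    (lt_mem_nhds (ENNReal.ofReal_pos.2 (ids_pos hlam ht)))] with i h1 h2
  by_contra hc
  refine h2.ne' (measure_mono_null (fun E hE => ?_) (ae_iff.1 h1.ae_lt))
  exact not_lt.2 ((Set.mem_Iic.1 hE).trans (not_lt.1 hc))

section Asymptotics

variable {ι : Type*} {l : Filter ι} [l.IsCountablyGenerated] {L : ι → ℝ} {X : ι → Set ℝ}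
  {lam β ρ : ℝ}

lemma HasPoissonVoids.tendsto_density (h : HasPoissonVoids l L X lam) (hlam : 0 < lam)
    (hβ : 0 < β) {ν : ℝ} (hν : ν < 0) :
    Tendsto (fun i => ∫⁻ E in Set.Ioi 0, ENNReal.ofReal (bose β ν E) ∂idsMeasure (L i) (X i)) l
      (𝓝 (ENNReal.ofReal (rho lam β ν))) := by
  have := h.tendsto_lintegral_bose hlam hβ le_rfl (tendsto_const_nhds (x := ν)) hν
  rwa [lintegral_dos_mul_bose hlam hβ hν.le le_rfl] at this

/-- If `μ i ≤ ν`, monotonicity makes the density at `ν` at least `ρ`, while it converges to `rho lam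
β ν < ρ`. `eventually_gt` is the mirror image. -/
lemma HasPoissonVoids.eventually_lt (h : HasPoissonVoids l L X lam) (hlam : 0 < lam)
    (hβ : 0 < β) (hρ : 0 < ρ) {μ : ι → ℝ}
    (hμ : ∀ᶠ i in l, SolvesDensityEq (L i) (X i) β ρ (μ i)) {ν : ℝ} (hν : ν < 0)
    (hνρ : rho lam β ν < ρ) : ∀ᶠ i in l, ν < μ i := by
  filter_upwards [hμ, h.length_pos, (h.tendsto_density hlam hβ hν).eventually
    (gt_mem_nhds ((ENNReal.ofReal_lt_ofReal_iff hρ).2 hνρ))] with i h1 h2 h3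
  by_contra hc
  exact absurd (h1.le_lintegral h2 hβ (not_lt.1 hc) hν.le) h3.not_ge

lemma HasPoissonVoids.eventually_gt (h : HasPoissonVoids l L X lam) (hlam : 0 < lam)
    (hβ : 0 < β) (hρ : 0 < ρ) {μ : ι → ℝ}
    (hμ : ∀ᶠ i in l, SolvesDensityEq (L i) (X i) β ρ (μ i)) {ν : ℝ} (hν : ν < 0)
    (hνρ : ρ < rho lam β ν) : ∀ᶠ i in l, μ i < ν := by
  filter_upwards [hμ, h.length_pos, (h.tendsto_density hlam hβ hν).eventually
    (lt_mem_nhds ((ENNReal.ofReal_lt_ofReal_iff (hρ.trans hνρ)).2 hνρ))] with i h1 h2 h3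
  by_contra hc
  exact absurd (h1.lintegral_le h2 hβ (not_lt.1 hc)) h3.not_ge

lemma HasPoissonVoids.tendsto_chemicalPotential_of_lt (h : HasPoissonVoids l L X lam)
    (hlam : 0 < lam) (hβ : 0 < β) (hρ : 0 < ρ) {μ : ι → ℝ}
    (hμ : ∀ᶠ i in l, SolvesDensityEq (L i) (X i) β ρ (μ i)) {μ₀ : ℝ} (hμ₀ : μ₀ < 0)
    (hroot : rho lam β μ₀ = ρ) : Tendsto μ l (𝓝 μ₀) := by
  have hmono := strictMonoOn_rho hlam hβ
  refine tendsto_order.2 ⟨fun a ha => ?_, fun b hb => ?_⟩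
  · exact h.eventually_lt hlam hβ hρ hμ (ha.trans hμ₀)
      (hroot ▸ hmono (ha.trans hμ₀).le hμ₀.le ha)
  -- The comparison potential must be negative, hence the minimum with `0`.
  · obtain ⟨c, hc1, hc2⟩ := exists_between (lt_min hb hμ₀)
    have hc0 : c < 0 := hc2.trans_le (min_le_right _ _)
    filter_upwards [h.eventually_gt hlam hβ hρ hμ hc0 (hroot ▸ hmono hμ₀.le hc0.le hc1)] with i hi
    exact hi.trans (hc2.trans_le (min_le_left _ _))

lemma HasPoissonVoids.tendsto_chemicalPotential_of_ge (h : HasPoissonVoids l L X lam)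
    (hlam : 0 < lam) (hβ : 0 < β) (hρ : 0 < ρ) {μ : ι → ℝ}
    (hμ : ∀ᶠ i in l, SolvesDensityEq (L i) (X i) β ρ (μ i)) (hcrit : rho lam β 0 ≤ ρ) :
    Tendsto μ l (𝓝 0) := by
  refine tendsto_order.2 ⟨fun a ha => ?_, fun b hb => ?_⟩
  · exact h.eventually_lt hlam hβ hρ hμ ha
      ((strictMonoOn_rho hlam hβ ha.le Set.self_mem_Iic ha).trans_le hcrit)
  · exact h.eventually_lt_of_pos hlam hμ hb

lemma HasPoissonVoids.tendsto_lowEnergyDensity (h : HasPoissonVoids l L X lam)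
    (hlam : 0 < lam) (hβ : 0 < β) (hρ : 0 < ρ) {μ : ι → ℝ}
    (hμ : ∀ᶠ i in l, SolvesDensityEq (L i) (X i) β ρ (μ i)) {μ₀ : ℝ} (hμ₀ : μ₀ ≤ 0)
    (hlim : Tendsto μ l (𝓝 μ₀)) {ε : ℝ} (hε : 0 < ε) :
    Tendsto (fun i => lowEnergyDensity (L i) (X i) β (μ i) ε) l
      (𝓝 (ρ - ∫ E in Set.Ioi ε, dos lam E * bose β μ₀ E)) := by
  have key := h.tendsto_lintegral_bose hlam hβ hε.le hlim (hμ₀.trans_lt hε)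
  rw [lintegral_dos_mul_bose hlam hβ hμ₀ hε.le] at key
  have hnn : 0 ≤ ∫ E in Set.Ioi ε, dos lam E * bose β μ₀ E :=
    setIntegral_nonneg measurableSet_Ioi fun E hE =>
      dos_mul_bose_nonneg hlam hβ hμ₀ (hε.trans hE)
  have key' := ((ENNReal.tendsto_toReal ENNReal.ofReal_ne_top).comp key).const_sub ρ
  rw [ENNReal.toReal_ofReal hnn] at key'
  refine key'.congr' ?_
  filter_upwards [hμ, h.length_pos] with i h1 h2
  exact (h1.lowEnergyDensity_eq h2 hβ hρ.le hε).symm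

end Asymptotics

/-- Each regular `ω` is treated separately. The function `g ε` is `ρ` minus the limiting density
above `ε`; it tends to `ρ - rho lam β μ₀`, with `μ₀` the root below criticality and `0` otherwise.
-/
theorem condensationAsymptotics_of_hasPoissonVoids {Ω ι : Type*} [MeasurableSpace Ω]
    {P : Measure Ω} {l : Filter ι} [l.IsCountablyGenerated] {L : ι → ℝ} {X : ι → Ω → Set ℝ}
    {lam β ρ : ℝ} (hlam : 0 < lam) (hβ : 0 < β) (hρ : 0 < ρ)
    (h : ∀ᵐ ω ∂P, HasPoissonVoids l L (fun i => X i ω) lam) :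
    CondensationAsymptotics P l L X lam β ρ := by
  refine ⟨h.mono fun ω hω i hi => existsUnique_solvesDensityEq hi hβ hρ (hω.finite i),
    fun μ hμ => ⟨fun hc => ?_, fun hc => ?_⟩⟩
  · rw [rhoCrit_eq hlam hβ] at hc
    obtain ⟨μ₀, hμ₀, hroot⟩ := exists_rho_eq hlam hβ hρ hc
    have hlim : ∀ᵐ ω ∂P, Tendsto (fun i => μ i ω) l (𝓝 μ₀) := by
      filter_upwards [h, hμ] with ω h1 h2
        using h1.tendsto_chemicalPotential_of_lt hlam hβ hρ h2 hμ₀ hroot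
    refine ⟨⟨μ₀, hμ₀, hroot, fun m hm hmρ => (strictMonoOn_rho hlam hβ).injOn hm.le hμ₀.le
      (hmρ.trans hroot.symm), hlim⟩,
      fun ε => ρ - ∫ E in Set.Ioi ε, dos lam E * bose β μ₀ E, fun ε hε => ?_, ?_⟩
    · filter_upwards [h, hμ, hlim] with ω h1 h2 h3
        using h1.tendsto_lowEnergyDensity hlam hβ hρ h2 hμ₀.le h3 hε
    · simpa [hroot] using (tendsto_setIntegral_dos_mul_bose hlam hβ hμ₀.le).const_sub ρ
  · rw [rhoCrit_eq hlam hβ] at hc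
    have hlim : ∀ᵐ ω ∂P, Tendsto (fun i => μ i ω) l (𝓝 0) := by
      filter_upwards [h, hμ] with ω h1 h2
        using h1.tendsto_chemicalPotential_of_ge hlam hβ hρ h2 hc
    refine ⟨hlim, fun ε => ρ - ∫ E in Set.Ioi ε, dos lam E * bose β 0 E, fun ε hε => ?_, ?_⟩
    · filter_upwards [h, hμ, hlim] with ω h1 h2 h3
        using h1.tendsto_lowEnergyDensity hlam hβ hρ h2 le_rfl h3 hε
    · rw [rhoCrit_eq hlam hβ]
      exact (tendsto_setIntegral_dos_mul_bose hlam hβ le_rfl).const_sub ρ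

/-- It is enough to control the void fractions for a dense set of lengths. -/
lemma tendsto_voidFraction_of_rat {ι : Type*} {l : Filter ι} {L : ι → ℝ} {X : ι → Set ℝ}
    {lam : ℝ} (hL : ∀ᶠ i in l, 0 < L i)
    (h : ∀ q : ℚ, 0 < q →
      Tendsto (fun i => voidFraction (L i) (X i) q) l (𝓝 (Real.exp (-(lam * q)))))
    {x : ℝ} (hx : 0 < x) :
    Tendsto (fun i => voidFraction (L i) (X i) x) l (𝓝 (Real.exp (-(lam * x)))) := by
  have hcont : Continuous fun y : ℝ => Real.exp (-(lam * y)) := by fun_prop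
  -- Void fractions decrease with the length and the limit is continuous: a rational just above `x`
  -- gives the lower bound, one just below `x` the upper bound.
  refine tendsto_order.2 ⟨fun a ha => ?_, fun b hb => ?_⟩
  · obtain ⟨v, hv, hv'⟩ := exists_Ico_subset_of_mem_nhds (hcont.continuousAt.preimage_mem_nhds
      (lt_mem_nhds ha)) ⟨x + 1, by linarith⟩
    obtain ⟨q, hq1, hq2⟩ := exists_rat_btwn hv
    filter_upwards [hL, (h q (by exact_mod_cast hx.trans hq1)).eventually
      (lt_mem_nhds (hv' ⟨hq1.le, hq2⟩))] with i h1 h2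
    exact h2.trans_le (voidFraction_anti h1 _ hq1.le)
  · obtain ⟨u, hu, hu'⟩ := exists_Ioc_subset_of_mem_nhds (hcont.continuousAt.preimage_mem_nhds
      (gt_mem_nhds hb)) ⟨0, hx⟩
    obtain ⟨q, hq1, hq2⟩ := exists_rat_btwn (max_lt hu hx)
    filter_upwards [hL, (h q (by exact_mod_cast (le_max_right u 0).trans_lt hq1)).eventually
      (gt_mem_nhds (hu' ⟨(le_max_left u 0).trans_lt hq1, hq2.le⟩))] with i h1 h2
    exact (voidFraction_anti h1 _ hq2.le).trans_lt h2

/-! ### The bounded differences inequality -/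

lemma integrable_exp_mul_of_bounded {Ω : Type*} [MeasurableSpace Ω] {P : Measure Ω}
    [IsFiniteMeasure P] {f : Ω → ℝ} (hf : Measurable f) {B : ℝ} (hB : ∀ x, |f x| ≤ B) (t : ℝ) :
    Integrable (fun x => Real.exp (t * f x)) P := by
  refine Integrable.of_bound (by fun_prop) (Real.exp (|t| * B)) (Eventually.of_forall fun x => ?_)
  rw [Real.norm_of_nonneg (Real.exp_pos _).le, Real.exp_le_exp]
  calc t * f x ≤ |t * f x| := le_abs_self _
    _ = |t| * |f x| := abs_mul _ _
    _ ≤ _ := by gcongr; exact hB x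

/-- McDiarmid's inequality (with a non-optimal constant): a function of `n` independent variables
with bounded differences is sub-Gaussian. -/
theorem hasSubgaussianMGF_of_bounded_differences {α : Type*} [MeasurableSpace α] (μ : Measure α)
    [IsProbabilityMeasure μ] (c : NNReal) (n : ℕ) (f : (Fin n → α) → ℝ) (hf : Measurable f)
    (hb : ∃ B, ∀ x, |f x| ≤ B) (hd : ∀ x i a, |f x - f (Function.update x i a)| ≤ c) :
    HasSubgaussianMGF (fun x => f x - ∫ y, f y ∂Measure.pi (fun _ => μ)) (n * c ^ 2)
      (Measure.pi fun _ => μ) := by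
  induction n with
  | zero =>
    have h0 : ∀ x, f x - ∫ y, f y ∂Measure.pi (fun _ => μ) = 0 := fun x => by
      rw [integral_congr_ae (g := fun _ => f x) (Eventually.of_forall fun y => by
        simp only [Subsingleton.elim y x])]
      simp
    simp only [h0]
    simp
  -- Condition on the first coordinate `a`, with `g a` the mean over the others. The induction
  -- hypothesis handles `f - g a`, Hoeffding's lemma handles `g - m`, and the exponents add.
  | succ n ih =>
    obtain ⟨B, hB⟩ := hb
    set π := Measure.pi fun _ : Fin n => μ with hπ
    set e := MeasurableEquiv.piFinSuccAbove (fun _ : Fin (n + 1) => α) 0 with he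
    have hes : ∀ a x, e.symm (a, x) = Fin.cons a x := fun a x => by
      simp [he, MeasurableEquiv.piFinSuccAbove]; rfl
    have hmp : MeasurePreserving e.symm (μ.prod π) (Measure.pi fun _ => μ) :=
      (measurePreserving_piFinSuccAbove (fun _ : Fin (n + 1) => μ) 0).symm
    have hcons : Measurable fun p : α × (Fin n → α) => f (Fin.cons p.1 p.2) := by
      simp only [← hes, Prod.mk.eta]
      exact hf.comp e.symm.measurable
    have hfa : ∀ a, Measurable fun x => f (Fin.cons a x : Fin (n + 1) → α) := fun a =>
      hcons.comp (measurable_const.prodMk measurable_id)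
    have hfi : ∀ a, Integrable (fun x => f (Fin.cons a x : Fin (n + 1) → α)) π := fun a =>
      Integrable.of_bound (hfa a).aestronglyMeasurable B (Eventually.of_forall fun x => hB _)
    set g : α → ℝ := fun a => ∫ x, f (Fin.cons a x) ∂π with hg
    have hgm : Measurable g :=
      (hcons.stronglyMeasurable.integral_prod_right' (ν := π)).measurable
    have hgB : ∀ a, |g a| ≤ B := fun a => by
      have := norm_integral_le_of_norm_le_const (μ := π) (C := B)
        (f := fun x => f (Fin.cons a x)) (Eventually.of_forall fun x => hB (Fin.cons a x))
      simpa using this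
    have hgi : Integrable g μ := Integrable.of_bound hgm.aestronglyMeasurable B
      (Eventually.of_forall hgB)
    set m := ∫ a, g a ∂μ with hm
    have hmf : ∫ y, f y ∂Measure.pi (fun _ => μ) = m := by
      rw [← hmp.integral_comp' , integral_prod]
      · simp only [hes, hm, hg]
      · exact Integrable.of_bound (hf.comp e.symm.measurable).aestronglyMeasurable B
          (Eventually.of_forall fun x => hB _)
    have hgd : ∀ a b, |g a - g b| ≤ c := fun a b => by
      rw [hg, ← integral_sub (hfi a) (hfi b)]
      have := norm_integral_le_of_norm_le_const (μ := π) (C := c)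
        (f := fun x => f (Fin.cons a x) - f (Fin.cons b x))
        (Eventually.of_forall fun x => by
          have := hd (Fin.cons a x) 0 b
          rwa [Fin.update_cons_zero] at this)
      simpa using this
    have hgm' : ∀ a, |g a - m| ≤ c := fun a => by
      have e1 : g a - m = ∫ b, (g a - g b) ∂μ := by
        rw [integral_sub (integrable_const _) hgi]; simp [hm]
      rw [e1]
      have := norm_integral_le_of_norm_le_const (μ := μ) (C := c)
        (f := fun b => g a - g b) (Eventually.of_forall fun b => hgd a b)
      simpa using this
    have hHoeff : ∀ t, ∫ a, Real.exp (t * (g a - m)) ∂μ ≤ Real.exp (c ^ 2 * t ^ 2 / 2) := by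
      intro t
      -- The interval has width `2 c`, so Hoeffding's lemma gives the variance proxy `c ^ 2`.
      have := (hasSubgaussianMGF_of_mem_Icc (μ := μ) (a := m - c) (b := m + c)
        hgm.aemeasurable (Eventually.of_forall fun a => by
          have := abs_le.1 (hgm' a); constructor <;> linarith)).mgf_le t
      have e2 : ((‖(m + c) - (m - c)‖₊ / 2) ^ 2 : NNReal) = c ^ 2 := by
        congr 1
        ext
        push_cast
        rw [show m + (c : ℝ) - (m - c) = 2 * c by ring, Real.norm_of_nonneg (by positivity)]
        ring
      rw [e2] at this
      simpa [mgf] using this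
    have hbd : ∀ x, |f x - m| ≤ B + |m| := fun x => (abs_sub _ _).trans (by gcongr; exact hB x)
    rw [hmf]
    refine ⟨fun t => integrable_exp_mul_of_bounded (hf.sub_const m) hbd t, fun t => ?_⟩
    rw [mgf, ← hmp.integral_comp', integral_prod]
    · simp only [hes]
      have hin : ∀ a, ∫ x, Real.exp (t * (f (Fin.cons a x) - m)) ∂π
          ≤ Real.exp (n * c ^ 2 * t ^ 2 / 2) * Real.exp (t * (g a - m)) := by
        intro a
        have := (ih (fun x => f (Fin.cons a x)) (hfa a) ⟨B, fun x => hB _⟩ fun x i b => by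
          have := hd (Fin.cons a x) i.succ b
          rwa [← Fin.cons_update] at this).mgf_le t
        rw [mgf] at this
        have e3 : ∀ x, Real.exp (t * (f (Fin.cons a x) - m))
            = Real.exp (t * (f (Fin.cons a x) - g a)) * Real.exp (t * (g a - m)) := fun x => by
          rw [← Real.exp_add]; congr 1; ring
        simp only [e3]
        rw [integral_mul_const]
        gcongr
        simpa using this
      calc _ ≤ ∫ a, Real.exp (n * c ^ 2 * t ^ 2 / 2) * Real.exp (t * (g a - m)) ∂μ := by
            refine integral_mono_of_nonneg (Eventually.of_forall fun a => ?_) ?_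
              (Eventually.of_forall hin)
            · exact integral_nonneg fun x => (Real.exp_pos _).le
            · exact (integrable_exp_mul_of_bounded (hgm.sub_const m) hgm' t).const_mul _
        _ ≤ Real.exp (n * c ^ 2 * t ^ 2 / 2) * Real.exp (c ^ 2 * t ^ 2 / 2) := by
            rw [integral_const_mul]
            gcongr
            exact hHoeff t
        _ = _ := by
            rw [← Real.exp_add]; congr 1; push_cast; ring
    · exact hmp.integrable_comp_of_integrable
        (integrable_exp_mul_of_bounded (hf.sub_const m) hbd t)

/-! ### Independent uniform impurities -/

/-- The configurations with their void intervals. -/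
def voidRel (N : ℕ) (L x : ℝ) : Set ((Fin N → ℝ) × ℝ) :=
  {p | -(L / 2) ≤ p.2 ∧ p.2 + x ≤ L / 2 ∧ ∀ i, p.1 i ∈ (Set.Ioo p.2 (p.2 + x))ᶜ}

lemma measurableSet_voidRel (N : ℕ) (L x : ℝ) : MeasurableSet (voidRel N L x) := by
  have h1 : MeasurableSet {p : (Fin N → ℝ) × ℝ | -(L / 2) ≤ p.2} :=
    measurableSet_le measurable_const measurable_snd
  have h2 : MeasurableSet {p : (Fin N → ℝ) × ℝ | p.2 + x ≤ L / 2} :=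
    measurableSet_le (measurable_snd.add_const x) measurable_const
  have h3 : MeasurableSet {p : (Fin N → ℝ) × ℝ | ∀ i, p.1 i ∈ (Set.Ioo p.2 (p.2 + x))ᶜ} := by
    rw [Set.ofPred_forall]
    refine MeasurableSet.iInter fun i => ?_
    have hi : Measurable fun p : (Fin N → ℝ) × ℝ => p.1 i :=
      (measurable_pi_apply i).comp measurable_fst
    exact ((measurableSet_lt measurable_snd hi).inter
      (measurableSet_lt hi (measurable_snd.add_const x))).compl
  exact h1.inter (h2.inter h3)

lemma voidSet_range_eq {N : ℕ} (L x : ℝ) (ξ : Fin N → ℝ) :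
    voidSet L (Set.range ξ) x = Prod.mk ξ ⁻¹' voidRel N L x := by
  ext y
  simp only [voidSet, voidRel, Set.disjoint_right, Set.mem_range, forall_exists_index,
    forall_apply_eq_imp_iff, Set.mem_ofPred_eq, Set.mem_preimage, Set.mem_compl_iff]

lemma measurable_volume_voidSet {N : ℕ} (L x : ℝ) :
    Measurable fun ξ : Fin N → ℝ => volume.real (voidSet L (Set.range ξ) x) := by
  simp only [voidSet_range_eq, measureReal_def]
  exact (measurable_measure_prodMk_left (measurableSet_voidRel N L x)).ennreal_toReal

lemma volume_voidSet_ne_top (L : ℝ) (X : Set ℝ) (x : ℝ) : volume (voidSet L X x) ≠ ⊤ :=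
  measure_ne_top_of_subset (voidSet_subset_Icc L X x) (measure_Icc_lt_top (μ := volume)).ne

/-- A left end point `y` is lost only if the new position `a` falls in `(y, y + x)`, that is, if `y`
is in `(a - x, a)`. -/
lemma volume_voidSet_sub_update_le {N : ℕ} (L : ℝ) {x : ℝ} (hx : 0 ≤ x) (ξ : Fin N → ℝ)
    (i : Fin N) (a : ℝ) :
    volume.real (voidSet L (Set.range ξ) x)
      - volume.real (voidSet L (Set.range (Function.update ξ i a)) x) ≤ x := by
  refine (le_measureReal_sdiff (volume_voidSet_ne_top _ _ _)).trans ?_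
  calc _ ≤ volume.real (Set.Ioo (a - x) a) := by
        refine measureReal_mono ?_ measure_Ioo_lt_top.ne
        rintro y ⟨⟨h1, h2, h3⟩, h4⟩
        by_contra hy
        refine h4 ⟨h1, h2, ?_⟩
        rw [Set.disjoint_right] at h3 ⊢
        rintro _ ⟨j, rfl⟩
        by_cases hj : j = i
        · subst hj
          rw [Function.update_self]
          exact fun h => hy ⟨by linarith [h.2], h.1⟩
        · rw [Function.update_of_ne hj]
          exact h3 ⟨j, rfl⟩
    _ = x := by simp [hx]

lemma abs_volume_voidSet_sub_update_le {N : ℕ} (L : ℝ) {x : ℝ} (hx : 0 ≤ x) (ξ : Fin N → ℝ)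
    (i : Fin N) (a : ℝ) :
    |volume.real (voidSet L (Set.range ξ) x)
      - volume.real (voidSet L (Set.range (Function.update ξ i a)) x)| ≤ x := by
  refine abs_le.2 ⟨?_, volume_voidSet_sub_update_le L hx ξ i a⟩
  have := volume_voidSet_sub_update_le L hx (Function.update ξ i a) i (ξ i)
  rw [Function.update_idem, Function.update_eq_self] at this
  linarith

/-- The uniform law on the volume. -/
def uniformLaw (L : ℝ) : Measure ℝ := volume[|Set.Icc (-(L / 2)) (L / 2)]

lemma isProbabilityMeasure_uniformLaw {L : ℝ} (hL : 0 < L) :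
    IsProbabilityMeasure (uniformLaw L) := by
  refine cond_isProbabilityMeasure_of_finite ?_ measure_Icc_lt_top.ne
  rw [Real.volume_Icc]
  simp [hL]

lemma uniformLaw_compl_Ioo {L x y : ℝ} (hL : 0 < L) (hx : 0 ≤ x) (h1 : -(L / 2) ≤ y)
    (h2 : y + x ≤ L / 2) :
    uniformLaw L (Set.Ioo y (y + x))ᶜ = ENNReal.ofReal (1 - x / L) := by
  have := isProbabilityMeasure_uniformLaw hL
  have h3 : uniformLaw L (Set.Ioo y (y + x)) = ENNReal.ofReal (x / L) := by
    rw [uniformLaw, cond_apply measurableSet_Icc, Set.inter_eq_right.2, Real.volume_Icc,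
      Real.volume_Ioo, ← ENNReal.ofReal_inv_of_pos (by linarith),
      ← ENNReal.ofReal_mul (by rw [inv_nonneg]; linarith)]
    · congr 1; field_simp; ring
    · exact fun z hz => ⟨h1.trans hz.1.le, hz.2.le.trans h2⟩
  rw [prob_compl_eq_one_sub measurableSet_Ioo, h3, ENNReal.ofReal_sub _ (by positivity),
    ENNReal.ofReal_one]

/-- By Fubini: the left end point ranges over an interval of length `L - x`, and for each position
all `N` points miss the void independently, with probability `1 - x / L` each. -/
lemma integral_volume_voidSet {N : ℕ} {L x : ℝ} (hL : 0 < L) (hx : 0 ≤ x) (hxL : x ≤ L) :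
    ∫ ξ, volume.real (voidSet L (Set.range ξ) x) ∂Measure.pi (fun _ : Fin N => uniformLaw L)
      = L * (1 - x / L) ^ (N + 1) := by
  have := isProbabilityMeasure_uniformLaw hL
  have h0 : 0 ≤ 1 - x / L := sub_nonneg.2 ((div_le_one hL).2 hxL)
  simp only [measureReal_def]
  rw [integral_toReal]
  · simp only [voidSet_range_eq]
    rw [← Measure.prod_apply (measurableSet_voidRel N L x),
      Measure.prod_apply_symm (measurableSet_voidRel N L x)]
    have hy : ∀ y, Measure.pi (fun _ : Fin N => uniformLaw L) ((fun ξ => (ξ, y)) ⁻¹' voidRel N L x)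
        = (Set.Icc (-(L / 2)) (L / 2 - x)).indicator
          (fun _ => ENNReal.ofReal ((1 - x / L) ^ N)) y := by
      intro y
      by_cases hy : y ∈ Set.Icc (-(L / 2)) (L / 2 - x)
      · rw [Set.indicator_of_mem hy]
        have e : (fun ξ : Fin N → ℝ => (ξ, y)) ⁻¹' voidRel N L x
            = Set.univ.pi fun _ => (Set.Ioo y (y + x))ᶜ := by
          ext ξ
          have h2 : y + x ≤ L / 2 := by linarith [hy.2]
          simp [voidRel, hy.1, h2]
        rw [e, Measure.pi_pi, Finset.prod_const,
          uniformLaw_compl_Ioo hL hx hy.1 (by linarith [hy.2]), ← ENNReal.ofReal_pow h0]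
        simp
      · rw [Set.indicator_of_notMem hy]
        have e : (fun ξ : Fin N → ℝ => (ξ, y)) ⁻¹' voidRel N L x = ∅ := by
          ext ξ
          simp only [voidRel, Set.mem_preimage, Set.mem_ofPred_eq, Set.mem_empty_iff_false, iff_false]
          exact fun h => hy ⟨h.1, by linarith [h.2.1]⟩
        rw [e, measure_empty]
    simp only [hy]
    rw [lintegral_indicator_const measurableSet_Icc, Real.volume_Icc,
      ← ENNReal.ofReal_mul (by positivity), ENNReal.toReal_ofReal, pow_succ]
    · field_simp; ring
    · exact mul_nonneg (by positivity) (by linarith)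
  · simp only [voidSet_range_eq]
    exact (measurable_measure_prodMk_left (measurableSet_voidRel N L x)).aemeasurable
  · exact Eventually.of_forall fun ξ => (volume_voidSet_ne_top _ _ _).lt_top

lemma measure_voidSet_deviation_le {N : ℕ} {L x : ℝ} (hL : 0 < L) (hx : 0 ≤ x) (hxL : x ≤ L)
    {ε : ℝ} (hε : 0 ≤ ε) :
    (Measure.pi fun _ : Fin N => uniformLaw L).real
      {ξ | ε ≤ |volume.real (voidSet L (Set.range ξ) x) - L * (1 - x / L) ^ (N + 1)|}
      ≤ 2 * Real.exp (-ε ^ 2 / (2 * (N * x ^ 2))) := by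
  have := isProbabilityMeasure_uniformLaw hL
  have hsub := hasSubgaussianMGF_of_bounded_differences (uniformLaw L) ⟨x, hx⟩ N
    (fun ξ => volume.real (voidSet L (Set.range ξ) x)) (measurable_volume_voidSet L x)
    ⟨volume.real (Set.Icc (-(L / 2)) (L / 2 - x)), fun ξ => by
      rw [abs_of_nonneg measureReal_nonneg]
      exact measureReal_mono (voidSet_subset_Icc _ _ _) measure_Icc_lt_top.ne⟩
    (fun ξ i a => abs_volume_voidSet_sub_update_le L hx ξ i a)
  rw [integral_volume_voidSet hL hx hxL] at hsub
  have h1 := hsub.measure_ge_le hε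
  have h2 := hsub.neg.measure_ge_le hε
  have e : (((N * ⟨x, hx⟩ ^ 2 : NNReal)) : ℝ) = N * x ^ 2 := by push_cast; rfl
  rw [e] at h1 h2
  calc _ ≤ _ := measureReal_mono (fun ξ (hξ : ε ≤ |_|) => by
        rcases le_abs.1 hξ with h | h
        · exact Or.inl h
        · exact Or.inr h)
    _ ≤ _ := measureReal_union_le _ _
    _ ≤ _ := add_le_add h1 h2
    _ = _ := (two_mul _).symm

lemma IsUniformModel.tendsto_length {Ω : Type*} [MeasurableSpace Ω] {P : Measure Ω} {lam : ℝ}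
    {L : ℕ → ℝ} {ξ : (n : ℕ) → Fin (n - 1) → Ω → ℝ} (h : IsUniformModel P lam L ξ)
    (hlam : 0 < lam) : Tendsto L atTop atTop := by
  have h1 : Tendsto (fun n : ℕ => ((n : ℝ) / L n)⁻¹ * n) atTop atTop :=
    Tendsto.pos_mul_atTop (inv_pos.2 hlam) (h.concentration.inv₀ hlam.ne')
      tendsto_natCast_atTop_atTop
  refine h1.congr' ?_
  filter_upwards [eventually_gt_atTop 0] with n hn
  have : (n : ℝ) ≠ 0 := by exact_mod_cast hn.ne'
  have := (h.length_pos n).ne'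
  field_simp

lemma IsUniformModel.map_eq {Ω : Type*} [MeasurableSpace Ω] {P : Measure Ω}
    [IsProbabilityMeasure P] {lam : ℝ} {L : ℕ → ℝ} {ξ : (n : ℕ) → Fin (n - 1) → Ω → ℝ}
    (h : IsUniformModel P lam L ξ) (n : ℕ) :
    P.map (fun ω i => ξ n i ω) = Measure.pi fun _ => uniformLaw (L n) := by
  rw [(iIndepFun_iff_map_fun_eq_pi_map fun i => (h.measurable_point n i).aemeasurable).1
    (h.indep_points n)]
  congr 1
  funext i
  exact h.uniform_point n i

/-- A deviation of order `L n` for about `n` differences of size `x` has probability exponentially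
small in `n`. The summable half of Borel–Cantelli needs no independence between volumes. -/
lemma IsUniformModel.ae_eventually_deviation_lt {Ω : Type*} [MeasurableSpace Ω] {P : Measure Ω}
    [IsProbabilityMeasure P] {lam : ℝ} {L : ℕ → ℝ} {ξ : (n : ℕ) → Fin (n - 1) → Ω → ℝ}
    (h : IsUniformModel P lam L ξ) (hlam : 0 < lam) {x η : ℝ} (hx : 0 < x) (hη : 0 < η) :
    ∀ᵐ ω ∂P, ∀ᶠ n in atTop,
      |voidFraction (L n) (Set.range fun i => ξ n i ω) x - (1 - x / L n) ^ n| < η := by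
  set s : ℕ → Set Ω := fun n => {ω | η * L n ≤ |volume.real (voidSet (L n)
    (Set.range fun i => ξ n i ω) x) - L n * (1 - x / L n) ^ (n - 1 + 1)|} with hs
  -- From `n ≤ 2 * lam * L n`, the exponent `(η L)² / (2 n x²)` is at least `κ n`.
  set κ := η ^ 2 / (8 * lam ^ 2 * x ^ 2) with hκ
  have hκ0 : 0 < κ := by positivity
  have hbound : ∀ᶠ n : ℕ in atTop, ‖P.real (s n)‖ ≤ 2 * Real.exp (-κ) ^ n := by
    -- With `n ≥ 2` there is an impurity, so the denominator containing `n - 1` is not zero.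
    filter_upwards [eventually_ge_atTop 2, (h.tendsto_length hlam).eventually_ge_atTop x,
      h.concentration.eventually (gt_mem_nhds (show lam < 2 * lam by linarith))] with n hn hxL hc
    have hL := h.length_pos n
    have hn1 : (1 : ℝ) ≤ ((n - 1 : ℕ) : ℝ) := by exact_mod_cast (by omega : 1 ≤ n - 1)
    have hnn : ((n - 1 : ℕ) : ℝ) ≤ n := by exact_mod_cast Nat.sub_le n 1
    have hn0 : (0 : ℝ) < n := by linarith
    rw [Real.norm_of_nonneg measureReal_nonneg]
    have key := measure_voidSet_deviation_le (N := n - 1) hL hx.le hxL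
      (mul_pos hη hL).le
    rw [← h.map_eq n, map_measureReal_apply (measurable_pi_lambda _ (h.measurable_point n))
      (measurableSet_le measurable_const
        (((measurable_volume_voidSet _ _).sub_const _).abs))] at key
    refine key.trans ?_
    rw [← Real.exp_nat_mul]
    gcongr
    rw [neg_div, mul_neg, neg_le_neg_iff, hκ]
    have h1 : (n : ℝ) ≤ 2 * lam * L n := ((div_lt_iff₀ hL).1 hc).le
    calc (n : ℝ) * (η ^ 2 / (8 * lam ^ 2 * x ^ 2))
        = η ^ 2 * (n : ℝ) ^ 2 / (4 * lam ^ 2) / (2 * (n * x ^ 2)) := by field_simp; norm_num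
      _ ≤ η ^ 2 * (2 * lam * L n) ^ 2 / (4 * lam ^ 2) / (2 * (n * x ^ 2)) := by gcongr
      _ = (η * L n) ^ 2 / (2 * (n * x ^ 2)) := by field_simp; norm_num
      _ ≤ (η * L n) ^ 2 / (2 * (((n - 1 : ℕ) : ℝ) * x ^ 2)) := by gcongr
  have hsum : Summable fun n => P.real (s n) :=
    Summable.of_norm_bounded_eventually_nat ((summable_geometric_of_lt_one (Real.exp_pos _).le
      (Real.exp_lt_one_iff.2 (neg_lt_zero.2 hκ0))).mul_left 2) hbound
  have hne : ∑' n, P (s n) ≠ ⊤ := by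
    have := hsum.tsum_ofReal_ne_top
    have e : ∀ n, ENNReal.ofReal (P.real (s n)) = P (s n) := fun n => ofReal_measureReal
    simpa only [e] using this
  filter_upwards [ae_eventually_notMem hne] with ω hω
  filter_upwards [hω, eventually_gt_atTop 0] with n hn hn0
  have hL := h.length_pos n
  have hn : |volume.real (voidSet (L n) (Set.range fun i => ξ n i ω) x)
      - L n * (1 - x / L n) ^ (n - 1 + 1)| < η * L n := not_le.1 hn
  rw [Nat.sub_add_cancel hn0] at hn
  have e : voidFraction (L n) (Set.range fun i => ξ n i ω) x - (1 - x / L n) ^ n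
      = (volume.real (voidSet (L n) (Set.range fun i => ξ n i ω) x)
        - L n * (1 - x / L n) ^ n) / L n := by
    unfold voidFraction; field_simp
  rw [e, abs_div, abs_of_pos hL, div_lt_iff₀ hL]
  exact hn

theorem IsUniformModel.ae_hasPoissonVoids {Ω : Type*} [MeasurableSpace Ω] {P : Measure Ω}
    [IsProbabilityMeasure P] {lam : ℝ} {L : ℕ → ℝ} {ξ : (n : ℕ) → Fin (n - 1) → Ω → ℝ}
    (h : IsUniformModel P lam L ξ) (hlam : 0 < lam) :
    ∀ᵐ ω ∂P, HasPoissonVoids atTop L (fun n => Set.range fun i => ξ n i ω) lam := by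
  have hall : ∀ᵐ ω ∂P, ∀ q : ℚ, 0 < q → ∀ k : ℕ, ∀ᶠ n in atTop,
      |voidFraction (L n) (Set.range fun i => ξ n i ω) q - (1 - q / L n) ^ n|
        < 1 / ((k : ℝ) + 1) := by
    rw [ae_all_iff]; intro q
    rw [ae_all_iff]; intro hq
    rw [ae_all_iff]; intro k
    exact h.ae_eventually_deviation_lt hlam (by exact_mod_cast hq) (by positivity)
  filter_upwards [hall] with ω hω
  have hpos : ∀ᶠ n in atTop, 0 < L n := Eventually.of_forall h.length_pos
  refine ⟨hpos, fun n => (Set.finite_range _).inter_of_left _, fun x hx =>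
    tendsto_voidFraction_of_rat hpos (fun q hq => ?_) hx⟩
  have h1 : Tendsto (fun n : ℕ => (1 - (q : ℝ) / L n) ^ n) atTop (𝓝 (Real.exp (-(lam * q)))) := by
    have : Tendsto (fun n : ℕ => (n : ℝ) * (-((q : ℝ) / L n))) atTop (𝓝 (-(lam * q))) := by
      refine (h.concentration.mul_const (q : ℝ)).neg.congr fun n => ?_
      ring
    simpa [sub_eq_add_neg] using Real.tendsto_one_add_pow_exp_of_tendsto this
  have h2 : Tendsto (fun n => voidFraction (L n) (Set.range fun i => ξ n i ω) q
      - (1 - (q : ℝ) / L n) ^ n) atTop (𝓝 0) := by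
    refine Metric.tendsto_nhds.2 fun ε hε => ?_
    obtain ⟨k, hk⟩ := exists_nat_one_div_lt hε
    filter_upwards [hω q hq k] with n hn
    rw [Real.dist_eq, sub_zero]
    exact hn.trans hk
  simpa using h2.add h1

/-! ### Poisson impurities -/

/-- The left end points of the void intervals of length `x` inside `[0, R]`. -/
def halfVoidSet (R : ℝ) (X : Set ℝ) (x : ℝ) : Set ℝ :=
  {y | 0 ≤ y ∧ y + x ≤ R ∧ Disjoint (Set.Ioo y (y + x)) X}

/-- The indicator of the event that `B` is free of impurities. -/
def voidInd (X B : Set ℝ) : ℝ := if (X ∩ B).encard = 0 then 1 else 0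

/-- A window of `m` consecutive cells of length `δ`. -/
def window (δ : ℝ) (m k : ℕ) : Set ℝ := Set.Ico (k * δ) ((k + m) * δ)

/-- The number of void windows among the first `K`. -/
def voidCount (X : Set ℝ) (δ : ℝ) (m K : ℕ) : ℝ := ∑ k ∈ Finset.range K, voidInd X (window δ m k)

lemma halfVoidSet_subset_Icc (R : ℝ) (X : Set ℝ) (x : ℝ) :
    halfVoidSet R X x ⊆ Set.Icc 0 (R - x) :=
  fun _ hz => ⟨hz.1, by linarith [hz.2.1]⟩

lemma volume_halfVoidSet_ne_top (R : ℝ) (X : Set ℝ) (x : ℝ) : volume (halfVoidSet R X x) ≠ ⊤ :=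
  measure_ne_top_of_subset (halfVoidSet_subset_Icc R X x) (measure_Icc_lt_top (μ := volume)).ne

lemma voidCount_eq_card (X : Set ℝ) (δ : ℝ) (m K : ℕ) :
    voidCount X δ m K = ((Finset.range K).filter fun k => (X ∩ window δ m k).encard = 0).card := by
  unfold voidCount voidInd
  rw [Finset.sum_boole]

lemma volume_real_cell {δ : ℝ} (hδ : 0 < δ) (k : ℕ) :
    volume.real (Set.Ico ((k : ℝ) * δ) ((k + 1) * δ)) = δ := by
  rw [Real.volume_real_Ico_of_le (by nlinarith)]; ring

/-- A void interval of `m + 1` cell lengths contains the window of `m` cells starting at the first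
cell boundary after `y`; hence `y` lies in the cell just before a void window. -/
lemma volume_halfVoidSet_le {R δ : ℝ} (hδ : 0 < δ) (X : Set ℝ) {m K : ℕ}
    (hK : R < (K + m) * δ) :
    volume.real (halfVoidSet R X ((m + 1) * δ)) ≤ δ * voidCount X δ m K := by
  set T := (Finset.range K).filter fun k => (X ∩ window δ m k).encard = 0 with hT
  have hsub : halfVoidSet R X ((m + 1) * δ)
      ⊆ ⋃ k ∈ T, Set.Ico (((k : ℝ) - 1) * δ) (k * δ) := by
    rintro y ⟨h1, h2, h3⟩
    have hf1 : (⌊y / δ⌋₊ : ℝ) ≤ y / δ := Nat.floor_le (by positivity)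
    have hf2 : y / δ < ⌊y / δ⌋₊ + 1 := Nat.lt_floor_add_one _
    rw [le_div_iff₀ hδ] at hf1
    rw [div_lt_iff₀ hδ] at hf2
    simp only [Set.mem_iUnion]
    refine ⟨⌊y / δ⌋₊ + 1, ?_, by push_cast; linarith, by push_cast; exact hf2⟩
    rw [hT, Finset.mem_filter, Finset.mem_range]
    constructor
    · have : ((⌊y / δ⌋₊ : ℝ) + m + 1) * δ < (K + m) * δ := by nlinarith
      have := lt_of_mul_lt_mul_right this hδ.le
      have : (⌊y / δ⌋₊ : ℝ) + 1 < K := by linarith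
      exact_mod_cast this
    · rw [Set.encard_eq_zero, ← Set.disjoint_iff_inter_eq_empty, disjoint_comm]
      refine h3.mono_left fun z hz => ?_
      simp only [window, Set.mem_Ico] at hz
      push_cast at hz
      exact ⟨by linarith [hz.1], by nlinarith [hz.2]⟩
  calc _ ≤ volume.real (⋃ k ∈ T, Set.Ico (((k : ℝ) - 1) * δ) (k * δ)) := by
        refine measureReal_mono hsub ?_
        exact (measure_biUnion_lt_top T.finite_toSet fun _ _ => measure_Ico_lt_top).ne
    _ ≤ ∑ k ∈ T, volume.real (Set.Ico (((k : ℝ) - 1) * δ) (k * δ)) :=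
        measureReal_biUnion_finset_le _ _
    _ = ∑ k ∈ T, δ := by
        refine Finset.sum_congr rfl fun k _ => ?_
        rw [Real.volume_real_Ico_of_le (by nlinarith)]; ring
    _ = _ := by
        rw [Finset.sum_const, nsmul_eq_mul, voidCount_eq_card, mul_comm]

/-- Every point of the first cell of a void window of `m + 1` cells starts a void interval of `m`
cell lengths. Windows running past `R` cost at most the last term. -/
lemma voidCount_le_volume_halfVoidSet {R δ : ℝ} (hδ : 0 < δ) (X : Set ℝ) {m K : ℕ}
    (hK : K * δ ≤ R) :
    δ * voidCount X δ (m + 1) K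
      ≤ volume.real (halfVoidSet R X (m * δ)) + (m + 1) * δ := by
  set T := (Finset.range K).filter fun k => (X ∩ window δ (m + 1) k).encard = 0 with hT
  have hsub : (⋃ k ∈ T, Set.Ico ((k : ℝ) * δ) ((k + 1) * δ))
      ⊆ halfVoidSet R X (m * δ) ∪ Set.Icc (R - (m + 1) * δ) R := by
    simp only [Set.iUnion_subset_iff]
    intro k hk y hy
    rw [hT, Finset.mem_filter, Finset.mem_range, Set.encard_eq_zero,
      ← Set.disjoint_iff_inter_eq_empty, disjoint_comm] at hk
    obtain ⟨hkK, hd⟩ := hk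
    have hk0 : (0 : ℝ) ≤ k * δ := by positivity
    rcases le_or_gt ((k + (m + 1)) * δ) R with h | h
    · refine Or.inl ⟨hk0.trans hy.1, by nlinarith [hy.2], hd.mono_left fun z hz => ?_⟩
      simp only [window, Set.mem_Ico]
      push_cast
      exact ⟨hy.1.trans hz.1.le, by nlinarith [hz.2, hy.2]⟩
    · refine Or.inr ⟨by nlinarith [hy.1], hy.2.le.trans (le_trans ?_ hK)⟩
      gcongr
      exact_mod_cast hkK
  calc δ * voidCount X δ (m + 1) K
      = ∑ k ∈ T, volume.real (Set.Ico ((k : ℝ) * δ) ((k + 1) * δ)) := by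
        rw [Finset.sum_congr rfl fun k _ => volume_real_cell hδ k, Finset.sum_const,
          nsmul_eq_mul, voidCount_eq_card, mul_comm]
    _ = volume.real (⋃ k ∈ T, Set.Ico ((k : ℝ) * δ) ((k + 1) * δ)) := by
        refine (measureReal_biUnion_finset ?_ (fun _ _ => measurableSet_Ico)
          fun _ _ => measure_Ico_lt_top.ne).symm
        have key : ∀ j k : ℕ, j < k → Disjoint (Set.Ico ((j : ℝ) * δ) ((j + 1) * δ))
            (Set.Ico ((k : ℝ) * δ) ((k + 1) * δ)) := by
          intro j k hjk
          refine Set.disjoint_left.2 fun y hy hy' => ?_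
          have h1 : ((j : ℝ) + 1) * δ ≤ k * δ := by gcongr; exact_mod_cast hjk
          linarith [hy.2, hy'.1]
        intro j _ k _ hjk
        rcases lt_or_gt_of_ne hjk with h | h
        · exact key j k h
        · exact (key k j h).symm
    _ ≤ volume.real (halfVoidSet R X (m * δ) ∪ Set.Icc (R - (m + 1) * δ) R) :=
        measureReal_mono hsub (measure_union_lt_top (volume_halfVoidSet_ne_top _ _ _).lt_top
          measure_Icc_lt_top).ne
    _ ≤ _ := measureReal_union_le _ _
    _ = _ := by
        rw [Real.volume_real_Icc_of_le (by
          have : 0 ≤ ((m : ℝ) + 1) * δ := by positivity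
          linarith)]
        ring

lemma sum_range_mul_eq (a : ℕ → ℝ) (m M : ℕ) :
    ∑ k ∈ Finset.range (m * M), a k
      = ∑ r ∈ Finset.range m, ∑ j ∈ Finset.range M, a (m * j + r) := by
  induction M with
  | zero => simp
  | succ M ih =>
    rw [Nat.mul_succ, Finset.sum_range_add, ih, ← Finset.sum_add_distrib]
    exact Finset.sum_congr rfl fun r _ => (Finset.sum_range_succ _ _).symm

lemma identDistrib_indicator {Ω : Type*} [MeasurableSpace Ω] {P : Measure Ω}
    [IsProbabilityMeasure P] {A B : Set Ω} (hA : MeasurableSet A) (hB : MeasurableSet B)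
    (h : P A = P B) :
    IdentDistrib (A.indicator fun _ => (1 : ℝ)) (B.indicator fun _ => (1 : ℝ)) P P := by
  classical
  have mA : Measurable (A.indicator fun _ => (1 : ℝ)) := measurable_const.indicator hA
  have mB : Measurable (B.indicator fun _ => (1 : ℝ)) := measurable_const.indicator hB
  refine ⟨mA.aemeasurable, mB.aemeasurable, ?_⟩
  ext s hs
  rw [Measure.map_apply mA hs, Measure.map_apply mB hs, Set.indicator_const_preimage_eq_union,
    Set.indicator_const_preimage_eq_union]
  have hc : P Aᶜ = P Bᶜ := by rw [prob_compl_eq_one_sub hA, prob_compl_eq_one_sub hB, h]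
  split_ifs <;> simp [h, hc]

lemma voidInd_eq_indicator {Ω : Type*} (X : Ω → Set ℝ) (B : Set ℝ) :
    (fun ω => voidInd (X ω) B) = {ω | (X ω ∩ B).encard = 0}.indicator fun _ => (1 : ℝ) := by
  funext ω
  simp only [voidInd, Set.indicator, Set.mem_ofPred_eq]

/-- Reflection reduces the negative half-line to the positive one. -/
lemma IsPoissonProcess.neg {Ω : Type*} [MeasurableSpace Ω] {P : Measure Ω} {lam : ℝ}
    {X : Ω → Set ℝ} (h : IsPoissonProcess P lam X) :
    IsPoissonProcess P lam fun ω => Neg.neg ⁻¹' X ω := by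
  have hcard : ∀ (B : Set ℝ) ω, (Neg.neg ⁻¹' X ω ∩ B).encard = (X ω ∩ Neg.neg ⁻¹' B).encard := by
    intro B ω
    rw [← Set.encard_preimage_of_bijective (Equiv.neg ℝ).bijective (X ω ∩ Neg.neg ⁻¹' B)]
    congr 1
    ext y
    simp
  have hb : ∀ B : Set ℝ, Bornology.IsBounded B → Bornology.IsBounded (Neg.neg ⁻¹' B) :=
    fun B hB => by simpa using hB.neg
  refine ⟨fun B hB hB' => ?_, fun B hB hB' m => ?_, fun m B hB hB' hd => ?_⟩
  · simp only [hcard]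
    exact h.measurable_count _ (measurable_neg hB) (hb B hB')
  · simp only [hcard]
    have := h.law_count _ (measurable_neg hB) (hb B hB') m
    rwa [measureReal_def, Measure.measure_preimage_neg, ← measureReal_def] at this
  · simp only [hcard]
    exact h.indep_count m _ (fun i => measurable_neg (hB i)) (fun i => hb _ (hB' i))
      fun i j hij => (hd hij).preimage _

section Poisson

variable {Ω : Type*} [MeasurableSpace Ω] {P : Measure Ω} [IsProbabilityMeasure P] {lam : ℝ}
  {X : Ω → Set ℝ}

/-- The strong law of large numbers for void indicators of disjoint sets of equal size. -/
lemma IsPoissonProcess.ae_tendsto_average_voidInd (h : IsPoissonProcess P lam X)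
    {B : ℕ → Set ℝ} (hB : ∀ j, MeasurableSet (B j)) (hb : ∀ j, Bornology.IsBounded (B j))
    (hd : Pairwise fun i j => Disjoint (B i) (B j)) {v : ℝ} (hv : ∀ j, volume.real (B j) = v) :
    ∀ᵐ ω ∂P, Tendsto (fun M : ℕ => (∑ j ∈ Finset.range M, voidInd (X ω) (B j)) / M) atTop
      (𝓝 (Real.exp (-(lam * v)))) := by
  have hms : ∀ j, MeasurableSet {ω | (X ω ∩ B j).encard = 0} := fun j =>
    h.measurable_count _ (hB j) (hb j) (measurableSet_singleton 0)
  have hP : ∀ j, P {ω | (X ω ∩ B j).encard = 0} = ENNReal.ofReal (Real.exp (-(lam * v))) := by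
    intro j
    have := h.law_count _ (hB j) (hb j) 0
    simpa [hv j] using this
  have hint : ∫ ω, voidInd (X ω) (B 0) ∂P = Real.exp (-(lam * v)) := by
    rw [voidInd_eq_indicator, integral_indicator_const _ (hms 0), measureReal_def, hP]
    simp [(Real.exp_pos _).le]
  rw [← hint]
  refine strong_law_ae_real (fun j ω => voidInd (X ω) (B j)) ?_ ?_ ?_
  · simp only [voidInd_eq_indicator]
    exact (integrable_const 1).indicator (hms 0)
  -- Pairwise independence is enough for the strong law, so only pairs of sets are needed.
  · intro i j hij
    have hind := h.indep_count 2 ![B i, B j] (by simp [Fin.forall_fin_two, hB])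
      (by simp [Fin.forall_fin_two, hb]) (by
        intro a b hab
        fin_cases a <;> fin_cases b <;> simp at hab ⊢
        · exact hd hij
        · exact hd hij.symm)
    have hf : Measurable fun c : ℕ∞ => if c = 0 then (1 : ℝ) else 0 := measurable_from_top
    exact (hind.indepFun (show (0 : Fin 2) ≠ 1 by decide)).comp hf hf
  · intro j
    simp only [voidInd_eq_indicator]
    exact identDistrib_indicator (hms j) (hms 0) ((hP j).trans (hP 0).symm)

/-- Neighbouring windows overlap, but those whose indices agree modulo `m` are disjoint. The strong
law applies to each of the `m` residue classes, and the limits add. -/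
lemma IsPoissonProcess.ae_tendsto_voidCount (h : IsPoissonProcess P lam X) {δ : ℝ} (hδ : 0 < δ)
    (m : ℕ) :
    ∀ᵐ ω ∂P, Tendsto (fun M : ℕ => voidCount (X ω) δ m (m * M) / M) atTop
      (𝓝 (m * Real.exp (-(lam * (m * δ))))) := by
  have hres : ∀ r, ∀ᵐ ω ∂P, Tendsto (fun M : ℕ =>
      (∑ j ∈ Finset.range M, voidInd (X ω) (window δ m (m * j + r))) / M) atTop
      (𝓝 (Real.exp (-(lam * (m * δ))))) := by
    intro r
    refine h.ae_tendsto_average_voidInd (fun j => measurableSet_Ico)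
      (fun j => Metric.isBounded_Ico _ _) ?_ fun j => ?_
    · have key : ∀ i j : ℕ, i < j →
          Disjoint (window δ m (m * i + r)) (window δ m (m * j + r)) := by
        intro i j hij
        refine Set.disjoint_left.2 fun y hy hy' => ?_
        simp only [window, Set.mem_Ico] at hy hy'
        have : ((m * i + r : ℕ) : ℝ) + m ≤ ((m * j + r : ℕ) : ℝ) := by
          have : m * i + r + m ≤ m * j + r := by nlinarith
          exact_mod_cast this
        nlinarith [hy.2, hy'.1]
      intro i j hij
      rcases lt_or_gt_of_ne hij with h | h
      · exact key i j h
      · exact (key j i h).symm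
    · have : ((m * j + r : ℕ) : ℝ) * δ ≤ (((m * j + r : ℕ) : ℝ) + m) * δ := by gcongr; simp
      refine (Real.volume_real_Ico_of_le this).trans ?_
      ring
  rw [← ae_all_iff] at hres
  filter_upwards [hres] with ω hω
  have hsum := tendsto_finsetSum (Finset.range m) fun r _ => hω r
  rw [Finset.sum_const, Finset.card_range, nsmul_eq_mul] at hsum
  refine hsum.congr fun M => ?_
  rw [voidCount, sum_range_mul_eq, Finset.sum_div]

/-- The number of windows `K = m * ⌊R / (m δ)⌋` satisfies `K δ ≤ R < (K + m) δ`, as both comparisons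
with `halfVoidSet` require. -/
lemma tendsto_voidCount_floor {X : Set ℝ} {δ p : ℝ} (hδ : 0 < δ) {m : ℕ} (hm : 0 < m)
    (h : Tendsto (fun M : ℕ => voidCount X δ m (m * M) / M) atTop (𝓝 (m * p))) :
    Tendsto (fun R : ℝ => δ * voidCount X δ m (m * ⌊1 / (m * δ) * R⌋₊) / R) atTop (𝓝 p) := by
  have hm' : (0 : ℝ) < m := by exact_mod_cast hm
  have hfl : Tendsto (fun R : ℝ => ⌊1 / (m * δ) * R⌋₊) atTop atTop :=
    tendsto_nat_floor_atTop.comp (tendsto_id.const_mul_atTop (by positivity))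
  have h1 := ((h.comp hfl).mul (tendsto_nat_floor_mul_div_atTop
    (show (0 : ℝ) ≤ 1 / (m * δ) by positivity))).const_mul δ
  have e : δ * (m * p * (1 / (m * δ))) = p := by field_simp
  rw [e] at h1
  refine h1.congr' ?_
  filter_upwards [hfl.eventually_gt_atTop 0] with R hR
  have : (⌊1 / (m * δ) * R⌋₊ : ℝ) ≠ 0 := by exact_mod_cast hR.ne'
  simp only [Function.comp]
  generalize ⌊1 / (m * δ) * R⌋₊ = F at this ⊢
  field_simp

/-- Windows of length `x - x / (k + 2)` bound from above and windows of length `x + x / (k + 1)`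
from below; the limits pinch `exp (-(lam * x))`. Countably many meshes cost one null set. -/
lemma IsPoissonProcess.ae_tendsto_halfVoidSet (h : IsPoissonProcess P lam X) {x : ℝ}
    (hx : 0 < x) :
    ∀ᵐ ω ∂P, Tendsto (fun R => volume.real (halfVoidSet R (X ω) x) / R) atTop
      (𝓝 (Real.exp (-(lam * x)))) := by
  have hup : ∀ᵐ ω ∂P, ∀ k : ℕ, Tendsto (fun M : ℕ =>
      voidCount (X ω) (x / (k + 2)) (k + 1) ((k + 1) * M) / M) atTop
      (𝓝 ((k + 1 : ℕ) * Real.exp (-(lam * ((k + 1 : ℕ) * (x / (k + 2))))))) :=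
    ae_all_iff.2 fun k => h.ae_tendsto_voidCount (by positivity) (k + 1)
  have hdown : ∀ᵐ ω ∂P, ∀ k : ℕ, Tendsto (fun M : ℕ =>
      voidCount (X ω) (x / (k + 1)) (k + 1 + 1) ((k + 1 + 1) * M) / M) atTop
      (𝓝 ((k + 1 + 1 : ℕ) * Real.exp (-(lam * ((k + 1 + 1 : ℕ) * (x / (k + 1))))))) :=
    ae_all_iff.2 fun k => h.ae_tendsto_voidCount (by positivity) (k + 1 + 1)
  filter_upwards [hup, hdown] with ω hω1 hω2
  refine tendsto_of_squeeze_family (m := atTop)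
    (hi := fun (k : ℕ) R => x / (k + 2) * voidCount (X ω) (x / (k + 2)) (k + 1)
      ((k + 1) * ⌊1 / ((k + 1 : ℕ) * (x / (k + 2))) * R⌋₊) / R)
    (lo := fun (k : ℕ) R => x / (k + 1) * voidCount (X ω) (x / (k + 1)) (k + 1 + 1)
      ((k + 1 + 1) * ⌊1 / ((k + 1 + 1 : ℕ) * (x / (k + 1))) * R⌋₊) / R
      - ((k + 1 : ℕ) + 1) * (x / (k + 1)) / R)
    (hi' := fun k : ℕ => Real.exp (-(lam * ((k + 1 : ℕ) * (x / (k + 2))))))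
    (lo' := fun k : ℕ => Real.exp (-(lam * ((k + 1 + 1 : ℕ) * (x / (k + 1)))))) ?_ ?_ ?_ ?_ ?_ ?_
  · refine Eventually.of_forall fun k => ?_
    have h1 := tendsto_voidCount_floor (by positivity) (Nat.succ_pos _) (hω2 k)
    have h2 : Tendsto (fun R : ℝ => ((k + 1 : ℕ) + 1) * (x / (k + 1)) / R) atTop (𝓝 0) :=
      tendsto_const_nhds.div_atTop tendsto_id
    simpa using h1.sub h2
  · exact Eventually.of_forall fun k =>
      tendsto_voidCount_floor (by positivity) (Nat.succ_pos _) (hω1 k)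
  · refine Eventually.of_forall fun k => ?_
    filter_upwards [eventually_gt_atTop 0] with R hR
    rw [← sub_div]
    gcongr
    rw [sub_le_iff_le_add]
    have hδ : 0 < x / ((k : ℝ) + 1) := by positivity
    have hx' : (k + 1 : ℕ) * (x / ((k : ℝ) + 1)) = x := by push_cast; field_simp
    have key := voidCount_le_volume_halfVoidSet (R := R) hδ (X ω) (m := k + 1)
      (K := (k + 1 + 1) * ⌊1 / ((k + 1 + 1 : ℕ) * (x / ((k : ℝ) + 1))) * R⌋₊) (by
        have := Nat.floor_le
          (show 0 ≤ 1 / ((k + 1 + 1 : ℕ) * (x / ((k : ℝ) + 1))) * R by positivity)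
        rw [one_div, inv_mul_eq_div, le_div_iff₀ (by positivity)] at this
        rw [one_div, inv_mul_eq_div]
        push_cast at this ⊢
        linarith)
    rwa [hx'] at key
  · refine Eventually.of_forall fun k => ?_
    filter_upwards [eventually_gt_atTop 0] with R hR
    gcongr
    have hδ : 0 < x / ((k : ℝ) + 2) := by positivity
    have hx' : ((k + 1 : ℕ) + 1) * (x / ((k : ℝ) + 2)) = x := by push_cast; field_simp; ring
    have key := volume_halfVoidSet_le (R := R) hδ (X ω) (m := k + 1)
      (K := (k + 1) * ⌊1 / ((k + 1 : ℕ) * (x / ((k : ℝ) + 2))) * R⌋₊) (by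
        have := Nat.lt_floor_add_one (1 / ((k + 1 : ℕ) * (x / ((k : ℝ) + 2))) * R)
        rw [one_div, inv_mul_eq_div, div_lt_iff₀ (by positivity)] at this
        rw [one_div, inv_mul_eq_div]
        push_cast at this ⊢
        linarith)
    rwa [hx'] at key
  · have h1 : Tendsto (fun k : ℕ => x + x / ((k : ℝ) + 1)) atTop (𝓝 (x + 0)) :=
      (tendsto_const_nhds.div_atTop (tendsto_atTop_add_const_right _ _
        tendsto_natCast_atTop_atTop)).const_add x
    rw [add_zero] at h1
    refine Real.continuous_exp.continuousAt.tendsto.comp (((h1.congr fun k => ?_).const_mul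
      lam).neg)
    push_cast; field_simp
  · have h1 : Tendsto (fun k : ℕ => x - x / ((k : ℝ) + 2)) atTop (𝓝 (x - 0)) :=
      (tendsto_const_nhds.div_atTop (tendsto_atTop_add_const_right _ _
        tendsto_natCast_atTop_atTop)).const_sub x
    rw [sub_zero] at h1
    refine Real.continuous_exp.continuousAt.tendsto.comp (((h1.congr fun k => ?_).const_mul
      lam).neg)
    push_cast; field_simp; ring

/-- The Poisson weights of the finite counts add up to `1`, leaving no mass for an infinite count.
-/
lemma IsPoissonProcess.ae_finite_inter (h : IsPoissonProcess P lam X) (hlam : 0 < lam)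
    {B : Set ℝ} (hB : MeasurableSet B) (hb : Bornology.IsBounded B) :
    ∀ᵐ ω ∂P, (X ω ∩ B).Finite := by
  have hm := h.measurable_count B hB hb
  have hr : 0 ≤ lam * volume.real B := by positivity
  have hone : P (⋃ m : ℕ, {ω | (X ω ∩ B).encard = m}) = 1 := by
    rw [measure_iUnion]
    · simp only [h.law_count B hB hb]
      have hs := hasSum_one_poissonMeasure (lam * volume.real B).toNNReal
      rw [Real.coe_toNNReal _ hr] at hs
      have hs' : HasSum (fun m : ℕ => (lam * volume.real B) ^ m / (m.factorial : ℝ) *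
          Real.exp (-(lam * volume.real B))) 1 := by
        refine hs.congr_fun fun m => ?_
        ring
      rw [← ENNReal.ofReal_tsum_of_nonneg (fun m => by positivity) hs'.summable, hs'.tsum_eq,
        ENNReal.ofReal_one]
    · intro i j hij
      refine Set.disjoint_left.2 fun ω hi hj => hij ?_
      have : (i : ℕ∞) = j := (Eq.symm hi).trans hj
      exact_mod_cast this
    · exact fun m => hm (measurableSet_singleton _)
  have hae : ∀ᵐ ω ∂P, ω ∈ ⋃ m : ℕ, {ω | (X ω ∩ B).encard = m} :=
    (mem_ae_iff_prob_eq_one (MeasurableSet.iUnion fun m =>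
      hm (measurableSet_singleton _))).2 hone
  filter_upwards [hae] with ω hω
  obtain ⟨m, hm⟩ := Set.mem_iUnion.1 hω
  exact Set.finite_of_encard_eq_coe hm

lemma IsPoissonProcess.ae_locallyFinite (h : IsPoissonProcess P lam X) (hlam : 0 < lam) :
    ∀ᵐ ω ∂P, ∀ L : ℝ, (X ω ∩ Set.Ioo (-(L / 2)) (L / 2)).Finite := by
  have : ∀ᵐ ω ∂P, ∀ k : ℕ, (X ω ∩ Set.Ioo (-(k : ℝ)) k).Finite :=
    ae_all_iff.2 fun k => h.ae_finite_inter hlam measurableSet_Ioo (Metric.isBounded_Ioo _ _)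
  filter_upwards [this] with ω hω L
  obtain ⟨k, hk⟩ := exists_nat_ge (L / 2)
  exact (hω k).subset (Set.inter_subset_inter_right _ (Set.Ioo_subset_Ioo (by linarith) hk))

end Poisson

/-- Voids to the right of `0` are counted by `X`, those to its left by the reflected configuration
through `y ↦ -x - y`; the remaining ones contain `0` and start in an interval of length `x`. -/
lemma volume_voidSet_bounds (L : ℝ) (X : Set ℝ) {x : ℝ} (hx : 0 < x) :
    volume.real (halfVoidSet (L / 2) X x) + volume.real (halfVoidSet (L / 2) (Neg.neg ⁻¹' X) x)
        ≤ volume.real (voidSet L X x) ∧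
      volume.real (voidSet L X x) ≤ volume.real (halfVoidSet (L / 2) X x)
        + volume.real (halfVoidSet (L / 2) (Neg.neg ⁻¹' X) x) + x := by
  set V := voidSet L X x with hV
  set W := MeasurableEquiv.subLeft (-x) ⁻¹' halfVoidSet (L / 2) (Neg.neg ⁻¹' X) x with hW
  have hWvol : volume.real W = volume.real (halfVoidSet (L / 2) (Neg.neg ⁻¹' X) x) := by
    rw [measureReal_def, measureReal_def, hW, MeasurePreserving.measure_preimage_equiv]
    exact Measure.measurePreserving_sub_left volume (-x)
  have hWmem : ∀ y, y ∈ W ↔ y ∈ V ∧ y ≤ -x := by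
    intro y
    have hdis : Disjoint (Set.Ioo (-x - y) (-x - y + x)) (Neg.neg ⁻¹' X)
        ↔ Disjoint (Set.Ioo y (y + x)) X := by
      rw [Set.disjoint_right, Set.disjoint_right]
      constructor
      · intro h z hz hz'
        exact h (a := -z) (by simpa using hz) ⟨by linarith [hz'.2], by linarith [hz'.1]⟩
      · intro h z hz hz'
        exact h (a := -z) hz ⟨by linarith [hz'.2], by linarith [hz'.1]⟩
    change (0 ≤ -x - y ∧ -x - y + x ≤ L / 2 ∧ Disjoint (Set.Ioo (-x - y) (-x - y + x))
      (Neg.neg ⁻¹' X)) ↔ (-(L / 2) ≤ y ∧ y + x ≤ L / 2 ∧ Disjoint (Set.Ioo y (y + x)) X) ∧ y ≤ -x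
    rw [hdis]
    constructor
    · rintro ⟨h1, h2, h3⟩
      exact ⟨⟨by linarith, by linarith, h3⟩, by linarith⟩
    · rintro ⟨⟨h1, h2, h3⟩, h4⟩
      exact ⟨by linarith, by linarith, h3⟩
  have hVtop := volume_voidSet_ne_top L X x
  have hright : V ∩ Set.Ici 0 ⊆ halfVoidSet (L / 2) X x := fun y hy => ⟨hy.2, hy.1.2⟩
  have hsplit := measureReal_inter_add_sdiff (μ := volume) (s := V) (t := Set.Ici 0)
    measurableSet_Ici hVtop
  have hWtop : volume W ≠ ⊤ := measure_ne_top_of_subset (fun y hy => ((hWmem y).1 hy).1) hVtop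
  constructor
  · rw [← hWvol, ← hsplit]
    -- For `L < 0` both half-volumes are empty and the bound is trivial.
    by_cases hL : 0 ≤ L
    · refine add_le_add (measureReal_mono (fun y hy => ⟨⟨?_, hy.2⟩, hy.1⟩)
        (measure_ne_top_of_subset Set.inter_subset_left hVtop))
        (measureReal_mono (fun y hy => ?_) (measure_ne_top_of_subset Set.sdiff_subset hVtop))
      · linarith [hy.1]
      · obtain ⟨h1, h2⟩ := (hWmem y).1 hy
        exact ⟨h1, fun h => by linarith [Set.mem_Ici.1 h]⟩
    · have h1 : halfVoidSet (L / 2) X x = ∅ :=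
        Set.eq_empty_of_forall_notMem fun y hy => by linarith [hy.1, hy.2.1]
      have h2 : W = ∅ := Set.eq_empty_of_forall_notMem fun y hy => by
        obtain ⟨h1, h2⟩ := (hWmem y).1 hy
        linarith [h1.1]
      rw [h1, h2]
      simp only [measureReal_empty, add_zero]
      positivity
  · rw [← hWvol, ← hsplit, add_assoc]
    refine add_le_add (measureReal_mono hright (volume_halfVoidSet_ne_top _ _ _)) ?_
    calc _ ≤ volume.real (W ∪ Set.Icc (-x) 0) := by
          refine measureReal_mono (fun y hy => ?_)
            (measure_union_lt_top hWtop.lt_top measure_Icc_lt_top).ne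
          have hy2 : y < 0 := not_le.1 hy.2
          rcases le_total y (-x) with h | h
          · exact Or.inl ((hWmem y).2 ⟨hy.1, h⟩)
          · exact Or.inr ⟨h, hy2.le⟩
      _ ≤ _ := measureReal_union_le _ _
      _ = _ := by rw [Real.volume_real_Icc_of_le (by linarith)]; ring

theorem IsPoissonProcess.ae_hasPoissonVoids {Ω : Type*} [MeasurableSpace Ω] {P : Measure Ω}
    [IsProbabilityMeasure P] {lam : ℝ} {X : Ω → Set ℝ} (h : IsPoissonProcess P lam X)
    (hlam : 0 < lam) :
    ∀ᵐ ω ∂P, HasPoissonVoids (atTop : Filter ℝ) (fun L => L) (fun _ => X ω) lam := by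
  have h1 : ∀ᵐ ω ∂P, ∀ q : ℚ, 0 < q → Tendsto (fun R =>
      volume.real (halfVoidSet R (X ω) q) / R) atTop (𝓝 (Real.exp (-(lam * q)))) :=
    ae_all_iff.2 fun q => ae_all_iff.2 fun hq => h.ae_tendsto_halfVoidSet (by exact_mod_cast hq)
  have h2 : ∀ᵐ ω ∂P, ∀ q : ℚ, 0 < q → Tendsto (fun R =>
      volume.real (halfVoidSet R (Neg.neg ⁻¹' X ω) q) / R) atTop (𝓝 (Real.exp (-(lam * q)))) :=
    ae_all_iff.2 fun q => ae_all_iff.2 fun hq =>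
      h.neg.ae_tendsto_halfVoidSet (by exact_mod_cast hq)
  filter_upwards [h1, h2, h.ae_locallyFinite hlam] with ω hω1 hω2 hfin
  have hpos : ∀ᶠ L : ℝ in atTop, 0 < L := eventually_gt_atTop 0
  refine ⟨hpos, hfin, fun x hx => tendsto_voidFraction_of_rat hpos (fun q hq => ?_) hx⟩
  have hq' : (0 : ℝ) < q := by exact_mod_cast hq
  have hhalf : Tendsto (fun L : ℝ => L / 2) atTop atTop := tendsto_id.atTop_div_const two_pos
  have hlo := (((hω1 q hq).comp hhalf).add ((hω2 q hq).comp hhalf)).div_const 2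
  have hhi := hlo.add (tendsto_const_nhds.div_atTop tendsto_id : Tendsto (fun L : ℝ => (q : ℝ) / L)
    atTop (𝓝 0))
  rw [add_self_div_two] at hlo hhi
  rw [add_zero] at hhi
  refine tendsto_of_tendsto_of_tendsto_of_le_of_le' hlo hhi ?_ ?_
  · filter_upwards [hpos] with L hL
    have := (volume_voidSet_bounds L (X ω) hq').1
    simp only [Function.comp, voidFraction]
    rw [one_div, inv_mul_eq_div, le_div_iff₀ hL]
    refine le_trans (le_of_eq ?_) this
    field_simp
  · filter_upwards [hpos] with L hL
    have := (volume_voidSet_bounds L (X ω) hq').2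
    simp only [Function.comp, voidFraction]
    rw [one_div, inv_mul_eq_div, div_le_iff₀ hL]
    refine this.trans (le_of_eq ?_)
    field_simp

end LuttingerSy

end

/-! ### The main theorem for both impurity models -/

theorem mainTheorem5 {Ω : Type*} [MeasurableSpace Ω] (P : Measure Ω) [IsProbabilityMeasure P]
    (lam β ρ : ℝ) (hlam : 0 < lam) (hβ : 0 < β) (hρ : 0 < ρ) :
    -- the limit that defines the critical density exists
    Tendsto (fun μ => LuttingerSy.rho lam β μ) (𝓝[<] (0 : ℝ)) (𝓝 (LuttingerSy.rhoCrit lam β)) ∧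
    -- Poisson impurities on the line, volumes `[-L/2, L/2]` with `L → ∞`
    (∀ X : Ω → Set ℝ, LuttingerSy.IsPoissonProcess P lam X →
      LuttingerSy.CondensationAsymptotics P (atTop : Filter ℝ) (fun L => L) (fun _ ω => X ω)
        lam β ρ) ∧
    -- `n - 1` independent uniform impurities in volumes of length `L n`, `n → ∞`, `n / L n → lam`
    (∀ (L : ℕ → ℝ) (ξ : (n : ℕ) → Fin (n - 1) → Ω → ℝ), LuttingerSy.IsUniformModel P lam L ξ →
      LuttingerSy.CondensationAsymptotics P (atTop : Filter ℕ) L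
        (fun n ω => Set.range (fun i => ξ n i ω)) lam β ρ) := by
  refine ⟨?_, fun X hX => ?_, fun L ξ h => ?_⟩
  · rw [LuttingerSy.rhoCrit_eq hlam hβ]
    exact LuttingerSy.tendsto_rho_zero hlam hβ
  · exact LuttingerSy.condensationAsymptotics_of_hasPoissonVoids hlam hβ hρ
      (hX.ae_hasPoissonVoids hlam)
  · exact LuttingerSy.condensationAsymptotics_of_hasPoissonVoids hlam hβ hρ
      (h.ae_hasPoissonVoids hlam)
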